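/- Let $G$ be a finite abelian group (written additively) of exponent $n_1=2^m p_1^{m_1}\cdots p_r^{m_r}$, where $p_1,\dots,p_r$ are the distinct odd primes dividing $n_1$ and $m\ge 0$. Let $\chi$ be the character of $\mathbb{Z}_8^*$ with $\chi(1)=\chi(7)=1$ and $\chi(3)=\chi(5)=-1$; for odd $k$ let $\left(\frac{k}{4}\right)=1$ if $k\equiv 1\pmod 4$ and $-1$ if $k\equiv 3\pmod 4$; let $\left(\frac{k}{p}\right)$ be the Legendre symbol. For $w,w_0,w_1,\dots,w_r\in\{0,1\}$ such that $w_0=0$ if $m<3$ and $w=0$ if $m<2$, put $$\Delta=2^{w_0}(-1)^w\big((-1)^{(p_1-1)/2}p_1\big)^{w_1}\cdots\big((-1)^{(p_r-1)/2}p_r\big)^{w_r},\qquad (*)$$ $$H_\Delta=\Big\{k\in\mathbb{Z}_{n_1}^* : \chi(k)^{w_0}\Big(\frac{k}{4}\Big)^{w}\Big(\frac{k}{p_1}\Big)^{w_1}\cdots\Big(\frac{k}{p_r}\Big)^{w_r}=1\Big\}.$$ Then $H_\Delta$ is a subgroup of $\mathbb{Z}_{n_1}^*$, of index $2$ if $\Delta\ne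 1$. For $g,h\in G$ write $g\sim_\Delta h$ if $g=kh$ for some $k\in H_\Delta$; this is an equivalence relation on $G$. For $g\in G$ let $A_g$ be the matrix with rows and columns indexed by $G$ and $(A_g)_{u,v}=1$ if $v-u=g$ and $0$ otherwise; let $\mathcal{A}=\{A_g : g\in G\}$ be the group scheme of $G$, $\mathbb{C}[\mathcal{A}]$ its linear span over $\mathbb{C}$, and $A_C=\sum_{g\in C}A_g$ for $C\subseteq G$. Let $\Delta_0$ be a square-free integer (positive or negative, possibly $1$). There is a matrix in $\mathbb{C}[\mathcal{A}]$ with all entries in $\{0,1,-1\}$ whose eigenvalues all lie in $\mathbb{Q}(\sqrt{\Delta_0})$ and generate this field over $\mathbb{Q}$ (for $\Delta_0\ne 1$: whose eigenvalues lie in $\mathbb{Q}(\sqrt{\Delta_0})$ and are not all rational) if and only if $\Delta_0$ is of the form $(*)$ for some admissible $w,w_0,\dots,w_r$. Take any $\Delta$ as in $(*)$, and let $M=A_{C_1}-A_{C_2}$ for disjoint subsets $C_1,C_2$ of $G$ with $0\notin C_1\cup C_2$. Then: (i) All eigenvalues of $M$ lie in $\mathbb{Q}(\sqrt{\Delta})$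 if and only if both $C_1$ and $C_2$ are unions of equivalence classes of $\sim_\Delta$. (ii) All eigenvalues of $M$ are integer multiples of $\sqrt{\Delta}$ if and only if either $\Delta=1$ and both $C_1$ and $C_2$ are unions of equivalence classes of $\sim_1$, or $\Delta\neq 1$, $C_2=kC_1$ for some $k\in\mathbb{Z}_{n_1}^*\setminus H_\Delta$, and $C_1$ is a union of equivalence classes of $\sim_\Delta$ (in which case so is $C_2$). Moreover, suppose that all eigenvalues of $M$ are integer multiples of $\sqrt\Delta$. If $\Delta<0$, then the Cayley digraph $X(G,C_1)$ (with an arc from $g$ to $h$ when $h-g\in C_1$) is an oriented graph, and $M$ is its skew adjacency matrix (the $(u,v)$ entry is $1$ if there is an arc from $u$ to $v$, $-1$ if there is an arc from $v$ to $u$, and $0$ otherwise). If $\Delta>0$, then $C_1=-C_1$ and $C_2=-C_2$, and $M$ is the adjacency matrix of the signed Cayley graph $X(G,C_1,C_2)$, in which $u,v$ are joined by a positive edge (entry $1$) if $v-u\in C_1$ and by a negative edge (entry $-1$) if $v-u\in C_2$. -/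

import Mathlib

namespace CayleyEig

open NumberTheorySymbols

section Deltas

/-- The odd prime divisors of `n`, i.e. the primes `p₁, …, p_r` in `n = 2 ^ m p₁ ^ m₁ ⋯ p_r ^ m_r`. -/
def oddPrimes (n : ℕ) : Finset ℕ := n.primeFactors.erase 2

/-- Exponents `w₀, w, w₁, …, w_r ∈ {0, 1}`, the last `r` of them indexed by the odd prime divisors
of `n`, with `w₀ = 0` if `m < 3` and `w = 0` if `m < 2`, where `m` is the exponent of `2` in `n`. -/
structure Exponents (n : ℕ) where
  w₀ : Fin 2
  w : Fin 2
  e : oddPrimes n → Fin 2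
  w₀_eq_zero : n.factorization 2 < 3 → w₀ = 0
  w_eq_zero : n.factorization 2 < 2 → w = 0

variable {n : ℕ} (E : Exponents n)

/-- `Δ = 2 ^ w₀ (-1) ^ w ∏ ((-1) ^ ((p - 1) / 2) p) ^ w_p`. -/
def Exponents.delta : ℤ :=
  2 ^ (E.w₀ : ℕ) * (-1) ^ (E.w : ℕ) *
    ∏ p : oddPrimes n, ((-1) ^ (((p : ℕ) - 1) / 2) * ((p : ℕ) : ℤ)) ^ (E.e p : ℕ)

/-- `χ(j) ^ w₀ (j / 4) ^ w ∏ (j / p) ^ w_p` for an integer `j`. Here `ZMod.χ₈` is the character with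
`χ(1) = χ(7) = 1` and `χ(3) = χ(5) = -1`; `(j / 4)`, for odd `j`, is `1` or `-1` according as `j`
is `1` or `3` modulo `4`, which is `ZMod.χ₄`; and `J(j | p)` is the Legendre symbol as `p` is an odd
prime. -/
def Exponents.symb (j : ℤ) : ℤ :=
  ZMod.χ₈ (j : ZMod 8) ^ (E.w₀ : ℕ) * ZMod.χ₄ (j : ZMod 4) ^ (E.w : ℕ) *
    ∏ p : oddPrimes n, J(j | (p : ℕ)) ^ (E.e p : ℕ)

theorem Exponents.symb_one : E.symb 1 = 1 := by
  simp [Exponents.symb]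

theorem Exponents.symb_mul (i j : ℤ) : E.symb (i * j) = E.symb i * E.symb j := by
  simp only [Exponents.symb, Int.cast_mul, map_mul, jacobiSym.mul_left, mul_pow,
    Finset.prod_mul_distrib]
  ring

theorem dvd_of_factorization {n a : ℕ} (h : a ≤ n.factorization 2) : 2 ^ a ∣ n :=
  (pow_dvd_pow 2 h).trans (Nat.ordProj_dvd n 2)

theorem Exponents.symb_congr {i j : ℤ} (h : (n : ℤ) ∣ i - j) : E.symb i = E.symb j := by
  have key : ∀ d : ℕ, d ∣ n → ((i : ZMod d) = (j : ZMod d)) := fun d hd => by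
    have h1 : (d : ℤ) ∣ i - j := (Int.natCast_dvd_natCast.mpr hd).trans h
    exact ((ZMod.intCast_eq_intCast_iff_dvd_sub _ _ _).mpr h1).symm
  have h8 : ZMod.χ₈ (i : ZMod 8) ^ (E.w₀ : ℕ) = ZMod.χ₈ (j : ZMod 8) ^ (E.w₀ : ℕ) := by
    by_cases hm : n.factorization 2 < 3
    · simp [E.w₀_eq_zero hm]
    · rw [key 8 (dvd_of_factorization (a := 3) (by omega))]
  have h4 : ZMod.χ₄ (i : ZMod 4) ^ (E.w : ℕ) = ZMod.χ₄ (j : ZMod 4) ^ (E.w : ℕ) := by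
    by_cases hm : n.factorization 2 < 2
    · simp [E.w_eq_zero hm]
    · rw [key 4 (dvd_of_factorization (a := 2) (by omega))]
  unfold Exponents.symb
  rw [h8, h4]
  congr 1
  refine Finset.prod_congr rfl fun p _ => ?_
  have hp : (p : ℕ) ∣ n := Nat.dvd_of_mem_primeFactors (Finset.mem_of_mem_erase p.2)
  rw [jacobiSym.mod_left' ((ZMod.intCast_eq_intCast_iff' _ _ _).mp (key p hp))]

theorem Exponents.symb_cast_mul (k l : ZMod n) :
    E.symb ((k * l).cast : ℤ) = E.symb (k.cast : ℤ) * E.symb (l.cast : ℤ) := by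
  rw [← E.symb_mul]
  refine E.symb_congr ((ZMod.intCast_eq_intCast_iff_dvd_sub _ _ _).mp ?_)
  push_cast
  simp

theorem Exponents.symb_cast_one : E.symb ((1 : ZMod n).cast : ℤ) = 1 := by
  rw [← E.symb_one]
  refine E.symb_congr ((ZMod.intCast_eq_intCast_iff_dvd_sub _ _ _).mp ?_)
  simp

/-- The subgroup `H_Δ` of `(ℤ / n)ˣ`: the classes `k` with
`χ(k) ^ w₀ (k / 4) ^ w ∏ (k / p) ^ w_p = 1`, evaluated at an integer representing `k`. -/
def Exponents.H : Subgroup (ZMod n)ˣ where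
  carrier := {k | E.symb ((k : ZMod n).cast : ℤ) = 1}
  one_mem' := E.symb_cast_one
  mul_mem' := fun {k l} hk hl => by
    change E.symb _ = 1 at hk hl ⊢
    rw [Units.val_mul, E.symb_cast_mul, hk, hl, one_mul]
  inv_mem' := fun {k} hk => by
    change E.symb _ = 1 at hk ⊢
    have h := E.symb_cast_mul (k : ZMod n) ((k⁻¹ : (ZMod n)ˣ) : ZMod n)
    rw [Units.mul_inv, E.symb_cast_one, hk, one_mul] at h
    exact h.symm

end Deltas

section Group

variable {G : Type*} [AddCommGroup G]

/-- The product `k g` of `k ∈ (ℤ / n₁)ˣ` and `g ∈ G`, where `n₁` is the exponent of `G`. -/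
noncomputable def unitMul (k : (ZMod (AddMonoid.exponent G))ˣ) (g : G) : G :=
  ((k : ZMod (AddMonoid.exponent G)).cast : ℤ) • g

theorem zsmul_congr_exponent {i j : ℤ}
    (h : (i : ZMod (AddMonoid.exponent G)) = (j : ZMod (AddMonoid.exponent G))) (g : G) :
    i • g = j • g := by
  obtain ⟨c, hc⟩ := (ZMod.intCast_eq_intCast_iff_dvd_sub _ _ _).mp h
  have : j = i + c * (AddMonoid.exponent G : ℤ) := by linarith
  rw [this, add_smul, mul_smul, natCast_zsmul, AddMonoid.exponent_nsmul_eq_zero, smul_zero,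
    add_zero]

theorem unitMul_one (g : G) : unitMul (1 : (ZMod (AddMonoid.exponent G))ˣ) g = g := by
  conv_rhs => rw [← one_zsmul g]
  exact zsmul_congr_exponent (by simp) g

theorem unitMul_mul (k l : (ZMod (AddMonoid.exponent G))ˣ) (g : G) :
    unitMul (k * l) g = unitMul k (unitMul l g) := by
  unfold unitMul
  rw [smul_smul]
  exact zsmul_congr_exponent (by push_cast; simp) g

/-- The equivalence relation `∼_Δ` on `G`: `g ∼_Δ h` if and only if `g = k h` for some
`k ∈ H_Δ`. -/
def equivRel (E : Exponents (AddMonoid.exponent G)) : Setoid G where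
  r := fun g h => ∃ k ∈ E.H, g = unitMul k h
  iseqv :=
    { refl := fun g => ⟨1, E.H.one_mem, (unitMul_one g).symm⟩
      symm := by
        rintro g h ⟨k, hk, rfl⟩
        exact ⟨k⁻¹, E.H.inv_mem hk, by rw [← unitMul_mul, inv_mul_cancel, unitMul_one]⟩
      trans := by
        rintro g h l ⟨k, hk, rfl⟩ ⟨k', hk', rfl⟩
        exact ⟨k * k', E.H.mul_mem hk hk', by rw [unitMul_mul]⟩ }

/-- `C` is a union of equivalence classes of `r`. -/
def IsUnionOfClasses (r : Setoid G) (C : Set G) : Prop :=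
  ∃ S ⊆ r.classes, C = ⋃₀ S

end Group

section Eigenvalues

/-- The set of eigenvalues of a complex square matrix. -/
def eigenvalues {V : Type*} [Fintype V] [DecidableEq V] (M : Matrix V V ℂ) : Set ℂ :=
  {μ | Module.End.HasEigenvalue (Matrix.toLin' M) μ}

/-- The field `ℚ(√Δ)` as a subfield of `ℂ`. -/
noncomputable def quadField (Δ : ℤ) : IntermediateField ℚ ℂ :=
  IntermediateField.adjoin ℚ {Complex.sqrt (Δ : ℂ)}

/-- All entries of `M` are `0`, `1` or `-1`. -/
def IsZeroOneNegOne {V : Type*} (M : Matrix V V ℂ) : Prop :=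
  ∀ u v, M u v = 0 ∨ M u v = 1 ∨ M u v = -1

end Eigenvalues

section Scheme

variable (G : Type*) [AddCommGroup G] [Fintype G] [DecidableEq G]

variable {G} in
/-- The matrix `A_g` with `(u, v)` entry `1` if `v - u = g` and `0` otherwise. -/
def schemeMatrix (g : G) : Matrix G G ℂ :=
  Matrix.of fun u v => if v - u = g then 1 else 0

/-- The group scheme `{A_g : g ∈ G}` of `G`. -/
def groupScheme : Set (Matrix G G ℂ) := Set.range schemeMatrix

/-- The Bose–Mesner algebra of the group scheme of `G` over `ℂ`, i.e. the linear span of the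
scheme. -/
def boseMesner : Submodule ℂ (Matrix G G ℂ) := Submodule.span ℂ (groupScheme G)

variable {G} in
/-- `A_C`, the sum of the `A_g` with `g ∈ C`. -/
def connMatrix (C : Finset G) : Matrix G G ℂ := ∑ g ∈ C, schemeMatrix g

end Scheme

section Graphs

/-- The Cayley digraph `X(G, C)`: there is an arc from `g` to `h` if and only if `h - g ∈ C`. -/
def cayleyDigraph {G : Type*} [AddCommGroup G] (C : Finset G) : Digraph G where
  Adj g h := h - g ∈ C

/-- A digraph is an oriented graph if no arc is a loop or has its reverse as an arc. -/
def IsOriented {V : Type*} (D : Digraph V) : Prop :=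
  ∀ u v, D.Adj u v → ¬ D.Adj v u

open Classical in
/-- The skew adjacency matrix of an oriented graph. -/
noncomputable def skewAdjMatrix {V : Type*} (D : Digraph V) : Matrix V V ℂ :=
  Matrix.of fun u v => if D.Adj u v then 1 else if D.Adj v u then -1 else 0

/-- A signed graph: the edges of a simple graph are partitioned into positive and negative ones. -/
structure SignedGraph (V : Type*) where
  pos : SimpleGraph V
  neg : SimpleGraph V
  disjoint : Disjoint pos neg

open Classical in
/-- The signed adjacency matrix of a signed graph. -/
noncomputable def SignedGraph.adjMatrix {V : Type*} (X : SignedGraph V) : Matrix V V ℂ :=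
  Matrix.of fun u v => if X.pos.Adj u v then 1 else if X.neg.Adj u v then -1 else 0

/-- `C` is an inverse-closed subset of `G` without `0`, so that it is the connection set of an
undirected Cayley graph. -/
structure IsConnectionSet {G : Type*} [AddCommGroup G] (C : Finset G) : Prop where
  zero_notMem : 0 ∉ C
  neg_mem : ∀ g ∈ C, -g ∈ C

/-- The undirected Cayley graph with connection set `C`. -/
def cayleyGraph {G : Type*} [AddCommGroup G] (C : Finset G) (hC : IsConnectionSet C) :
    SimpleGraph G where
  Adj g h := h - g ∈ C
  symm := ⟨fun g h hgh => by simpa using hC.neg_mem _ hgh⟩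
  loopless := ⟨fun g hg => hC.zero_notMem (by simpa using hg)⟩

/-- The signed Cayley graph `X(G, C₁, C₂)`. -/
def signedCayley {G : Type*} [AddCommGroup G] (C₁ C₂ : Finset G) (h₁ : IsConnectionSet C₁)
    (h₂ : IsConnectionSet C₂) (hd : Disjoint C₁ C₂) : SignedGraph G where
  pos := cayleyGraph C₁ h₁
  neg := cayleyGraph C₂ h₂
  disjoint := by
    rw [disjoint_iff_inf_le]
    intro g h hgh
    exact (Finset.disjoint_left.mp hd hgh.1 hgh.2).elim

end Graphs

end CayleyEig

/-! A matrix `∑ c(g) A_g` is diagonalised by the characters `ψ` of `G`, with eigenvalues the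
character sums `∑ c(g) ψ(g)`. These lie in the cyclotomic field of level `n₁`, whose Galois group is
the group of units modulo `n₁`. The automorphism `σ_k` sends `ψ(g)` to `ψ(kg)`, so it acts on
eigenvalues by moving the coefficient function along `k⁻¹` (`gal_charSumCyclo`). Since `c` is
determined by its character sums, Galois conditions on all eigenvalues become symmetry conditions on
`c` (`gal_charSumCyclo_eq_iff`).

The arithmetic input is `σ_k(√Δ) = χ_Δ(k) √Δ`, where `χ_Δ` is the character with kernel `H_Δ`
(`Exponents.exists_sqrt_delta`); it comes from Gauss sums at the odd primes and explicit roots of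
unity at 2. Hence eigenvalues in `ℚ(√Δ)` mean that `c` is `H_Δ`-invariant, which is (i). Eigenvalues
in `ℤ√Δ` mean `c(kg) = χ_Δ(k) c(g)`, which is (ii): units outside `H_Δ` exchange `C₁` and `C₂`.
Integrality of the multiples uses that eigenvalues are algebraic integers and `Δ` is square-free.
The graph statements follow from complex conjugation, which turns `c(g)` into `c(-g)` and fixes or
negates `√Δ` according to its sign.

For the fields that occur, the eigenvalues force `√Δ₀` into the cyclotomic field, and
`exists_exponents_of_sqrt_mem_cyclo` puts `Δ₀` in the required form. Conversely, the `H_Δ`-orbit of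
an element of maximal order gives a matrix that generates `ℚ(√Δ)`. -/

namespace CayleyEig

open NumberTheorySymbols

/-! ### Square roots of `±p`, `2` and `-1` from roots of unity, with their Galois behaviour -/

section SquareRoots

variable {L : Type*} [Field L]

/-- The root is the quadratic Gauss sum: `σ` fixes the character values `±1` and shifts the additive
character by `j`, which multiplies the sum by the Legendre symbol of `j`. -/
theorem exists_sq_eq_of_primitiveRoot_prime [CharZero L] {p : ℕ} (hp : p.Prime) (hp2 : p ≠ 2) {ζ : L}
    (hζ : IsPrimitiveRoot ζ p) :
    ∃ s : L, s ^ 2 = (((-1) ^ ((p - 1) / 2) * (p : ℤ) : ℤ) : L) ∧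
      ∀ (σ : L →+* L) (j : ℕ), j.Coprime p → σ ζ = ζ ^ j → σ s = (J((j : ℤ) | p) : L) * s := by
  have : Fact p.Prime := ⟨hp⟩
  set ψ : AddChar (ZMod p) L := AddChar.zmodChar p hζ.pow_eq_one with hψ
  set χ : MulChar (ZMod p) L := (quadraticChar (ZMod p)).ringHomComp (Int.castRingHom L) with hχ
  have hrc : ringChar (ZMod p) ≠ 2 := by rwa [ZMod.ringChar_zmod_n]
  have hprim : ψ.IsPrimitive := AddChar.zmodChar_primitive_of_primitive_root p hζ
  have hχ2 : χ.IsQuadratic := (quadraticChar_isQuadratic (ZMod p)).comp _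
  have hχ1 : χ ≠ 1 := by
    intro h
    obtain ⟨a, ha⟩ := quadraticChar_exists_neg_one' hrc
    have h1 : χ a = 1 := by rw [h]; simp
    rw [hχ, MulChar.ringHomComp_apply, ha] at h1
    norm_num at h1
  refine ⟨gaussSum χ ψ, ?_, ?_⟩
  · rw [gaussSum_sq hχ1 hχ2 hprim, hχ, MulChar.ringHomComp_apply, ZMod.card,
      quadraticChar_neg_one hrc, ZMod.card, ZMod.χ₄_eq_neg_one_pow (hp.mod_two_eq_one_iff_ne_two.mpr hp2)]
    have : p / 2 = (p - 1) / 2 := by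
      have := hp.mod_two_eq_one_iff_ne_two.mpr hp2
      omega
    rw [this]
    simp
  · intro τ j hj hτ
    have hu : IsUnit (j : ZMod p) := (ZMod.isUnit_iff_coprime j p).mpr hj
    have h1 : τ (gaussSum χ ψ) = gaussSum χ (ψ.mulShift hu.unit) := by
      simp only [gaussSum, map_sum, map_mul]
      refine Finset.sum_congr rfl fun a _ => ?_
      congr 1
      · simp [hχ, MulChar.ringHomComp_apply]
      · have h3 : ((j : ZMod p) * a) = ((j * a.val : ℕ) : ZMod p) := by simp
        rw [AddChar.mulShift_apply, IsUnit.unit_spec, h3, hψ, AddChar.zmodChar_apply,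
          AddChar.zmodChar_apply', map_pow, hτ, pow_mul]
    have h2 : χ (hu.unit : ZMod p) = (J((j : ℤ) | p) : L) := by
      rw [← jacobiSym.legendreSym.to_jacobiSym, hχ, MulChar.ringHomComp_apply, legendreSym]
      simp
    rw [h1, gaussSum_mulShift_eq, hχ2.inv, h2]

theorem exists_sq_eq_two_of_primitiveRoot {ζ : L} (hζ : IsPrimitiveRoot ζ 8) :
    ∃ s : L, s ^ 2 = 2 ∧
      ∀ (σ : L →+* L) (j : ℕ), j.Coprime 2 → σ ζ = ζ ^ j →
        σ s = (ZMod.χ₈ ((j : ℤ) : ZMod 8) : L) * s := by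
  have h4 : ζ ^ 4 = -1 := by
    have h : IsPrimitiveRoot (ζ ^ 4) 2 := hζ.pow (by norm_num) (by norm_num)
    exact h.eq_neg_one_of_two_right
  -- This is `√2 = ζ + ζ⁻¹`. The exponents `±1` modulo 8 preserve the sum and `±3` negate it.
  refine ⟨ζ + ζ ^ 7, by linear_combination (ζ ^ 10 - ζ^6 +ζ^2 + 2 * ζ^4 - 2) * h4, ?_⟩
  intro τ j hj hτ
  have h8 : j % 8 = 1 ∨ j % 8 = 3 ∨ j % 8 = 5 ∨ j % 8 = 7 := by
    have := Nat.odd_iff.mp (Nat.coprime_two_right.mp hj)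
    omega
  have hc : ((j : ℤ) : ZMod 8) = ((j % 8 : ℕ) : ZMod 8) := by simp
  rw [map_add, map_pow, hτ, pow_eq_pow_mod j hζ.pow_eq_one, hc]
  rcases h8 with h | h | h | h <;> rw [h]
  · have : ZMod.χ₈ ((1 : ℕ) : ZMod 8) = 1 := by decide
    rw [this]; push_cast; ring
  · have : ZMod.χ₈ ((3 : ℕ) : ZMod 8) = -1 := by decide
    rw [this]; push_cast
    linear_combination (ζ ^ 17 - ζ ^ 13 + ζ ^ 9 - ζ ^ 5 + ζ + ζ ^ 3) * h4
  · have : ZMod.χ₈ ((5 : ℕ) : ZMod 8) = -1 := by decide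
    rw [this]; push_cast
    linear_combination (ζ ^ 31 - ζ ^ 27 + ζ ^ 23 - ζ ^ 19 + ζ ^ 15 - ζ ^ 11 + ζ ^ 7 + ζ) * h4
  · have : ZMod.χ₈ ((7 : ℕ) : ZMod 8) = 1 := by decide
    rw [this]; push_cast
    have h49 : (ζ ^ 7) ^ 7 = ζ := by
      rw [← pow_mul, pow_eq_pow_mod _ hζ.pow_eq_one, pow_one]
    rw [h49]; ring

theorem sq_neg_one_of_primitiveRoot {ζ : L} (hζ : IsPrimitiveRoot ζ 4) :
    ζ ^ 2 = -1 ∧ ∀ (σ : L →+* L) (j : ℕ), j.Coprime 2 → σ ζ = ζ ^ j →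
      σ ζ = (ZMod.χ₄ ((j : ℤ) : ZMod 4) : L) * ζ := by
  have h2 : ζ ^ 2 = -1 :=
    (hζ.pow (by norm_num) (by norm_num) : IsPrimitiveRoot (ζ ^ 2) 2).eq_neg_one_of_two_right
  refine ⟨h2, fun τ j hj hτ => ?_⟩
  have h4 : j % 4 = 1 ∨ j % 4 = 3 := by
    have := Nat.odd_iff.mp (Nat.coprime_two_right.mp hj)
    omega
  have hc : ((j : ℤ) : ZMod 4) = ((j % 4 : ℕ) : ZMod 4) := by simp
  rw [hτ, pow_eq_pow_mod j hζ.pow_eq_one, hc]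
  rcases h4 with h | h <;> rw [h]
  · have : ZMod.χ₄ ((1 : ℕ) : ZMod 4) = 1 := by decide
    rw [this]; simp
  · have : ZMod.χ₄ ((3 : ℕ) : ZMod 4) = -1 := by decide
    rw [this]; push_cast
    linear_combination ζ * h2

end SquareRoots

/-! ### The cyclotomic field inside `ℂ` and its Galois group -/

section Cyclotomic

/-- The cyclotomic field `ℚ(e^{2πi/n})` as a subfield of `ℂ`. -/
noncomputable def cyclo (n : ℕ) : IntermediateField ℚ ℂ :=
  IntermediateField.adjoin ℚ {Complex.exp (2 * Real.pi * Complex.I / n)}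

variable (n : ℕ) [NeZero n]

theorem isPrimitiveRoot_exp_cyclo :
    IsPrimitiveRoot (Complex.exp (2 * Real.pi * Complex.I / n)) n :=
  Complex.isPrimitiveRoot_exp n (NeZero.ne n)

instance : IsCyclotomicExtension {n} ℚ (cyclo n) := by
  have hζ := isPrimitiveRoot_exp_cyclo n
  have : IsAlgebraic ℚ (Complex.exp (2 * Real.pi * Complex.I / n)) :=
    (hζ.isIntegral (NeZero.pos n)).tower_top.isAlgebraic
  change IsCyclotomicExtension {n} ℚ (cyclo n).toSubalgebra
  rw [cyclo, IntermediateField.adjoin_simple_toSubalgebra_of_isAlgebraic this]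
  exact hζ.adjoin_isCyclotomicExtension ℚ

instance : IsGalois ℚ (cyclo n) := IsCyclotomicExtension.isGalois {n} ℚ (cyclo n)

instance : FiniteDimensional ℚ (cyclo n) := IsCyclotomicExtension.finiteDimensional {n} ℚ (cyclo n)

/-- The automorphism of the `n`-th cyclotomic field raising the `n`-th roots of unity to the
power `k`. -/
noncomputable def gal : (ZMod n)ˣ ≃* Gal(cyclo n/ℚ) :=
  (IsCyclotomicExtension.autEquivPow (cyclo n)
    (Polynomial.cyclotomic.irreducible_rat (NeZero.pos n))).symm

variable {n}

theorem gal_apply_of_pow_eq_one (k : (ZMod n)ˣ) {x : cyclo n} (hx : x ^ n = 1) :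
    gal n k x = x ^ (k : ZMod n).val := by
  have hζ := IsCyclotomicExtension.zeta_spec n ℚ (cyclo n)
  have h1 : gal n k (IsCyclotomicExtension.zeta n ℚ (cyclo n)) =
      IsCyclotomicExtension.zeta n ℚ (cyclo n) ^ (k : ZMod n).val := by
    have h := hζ.autToPow_spec ℚ (gal n k)
    have h2 : hζ.autToPow ℚ (gal n k) = k :=
      (IsCyclotomicExtension.autEquivPow (cyclo n)
        (Polynomial.cyclotomic.irreducible_rat (NeZero.pos n))).apply_symm_apply k
    rw [h2] at h
    exact h.symm
  obtain ⟨i, -, rfl⟩ := hζ.eq_pow_of_pow_eq_one hx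
  rw [map_pow, h1, ← pow_mul, ← pow_mul, mul_comm]

theorem mem_cyclo_of_pow_eq_one {x : ℂ} (hx : x ^ n = 1) : x ∈ cyclo n := by
  obtain ⟨i, -, rfl⟩ := (isPrimitiveRoot_exp_cyclo n).eq_pow_of_pow_eq_one hx
  have h : Complex.exp (2 * Real.pi * Complex.I / n) ∈ cyclo n :=
    IntermediateField.mem_adjoin_simple_self ℚ _
  exact pow_mem h i

theorem exists_rat_of_gal_fixed {x : cyclo n} (h : ∀ k, gal n k x = x) : ∃ q : ℚ, (x : ℂ) = q := by
  have : x ∈ (⊥ : IntermediateField ℚ (cyclo n)) := by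
    rw [IsGalois.mem_bot_iff_fixed]
    intro f
    obtain ⟨k, rfl⟩ := (gal n).surjective f
    exact h k
  obtain ⟨q, rfl⟩ := IntermediateField.mem_bot.mp this
  exact ⟨q, by simp⟩

theorem gal_fixes_cyclo_of_dvd {m : ℕ} (h : m ∣ n) (k : (ZMod n)ˣ)
    (hk : (k : ZMod n).val ≡ 1 [MOD m]) {x : cyclo n} (hx : (x : ℂ) ∈ cyclo m) : gal n k x = x := by
  have : NeZero m := ⟨fun h0 => NeZero.ne n (by simpa [h0] using h)⟩
  -- The fixed field of `σ_k`, pushed into `ℂ`, is an intermediate field, so it contains `cyclo m`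
  -- as soon as it contains the generating root of unity.
  let F : IntermediateField ℚ (cyclo n) :=
    IntermediateField.fixedField (Subgroup.zpowers (gal n k))
  have hF : cyclo m ≤ F.map (cyclo n).val := by
    refine IntermediateField.adjoin_le_iff.mpr ?_
    rintro _ rfl
    have hz := (isPrimitiveRoot_exp_cyclo m).pow_eq_one
    have hz' : Complex.exp (2 * Real.pi * Complex.I / m) ^ n = 1 := by
      obtain ⟨c, rfl⟩ := h
      rw [pow_mul, hz, one_pow]
    have key : gal n k ⟨_, mem_cyclo_of_pow_eq_one hz'⟩ = ⟨_, mem_cyclo_of_pow_eq_one hz'⟩ := by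
      rw [gal_apply_of_pow_eq_one k (Subtype.ext hz')]
      refine Subtype.ext ?_
      change Complex.exp (2 * Real.pi * Complex.I / m) ^ _ = _
      rw [pow_eq_pow_mod _ hz, hk, ← pow_eq_pow_mod _ hz, pow_one]
    refine ⟨⟨_, mem_cyclo_of_pow_eq_one hz'⟩, ?_, rfl⟩
    rintro ⟨f, hf⟩
    have hle : Subgroup.zpowers (gal n k) ≤
        MulAction.stabilizer _ (⟨_, mem_cyclo_of_pow_eq_one hz'⟩ : cyclo n) :=
      Subgroup.zpowers_le.mpr (MulAction.mem_stabilizer_iff.mpr key)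
    exact hle hf
  obtain ⟨y, hy, hyx⟩ := hF hx
  have : y = x := Subtype.ext hyx
  subst this
  exact hy ⟨gal n k, Subgroup.mem_zpowers _⟩

end Cyclotomic

/-! ### The square root of `Δ`, the character `χ_Δ` and the field `ℚ(√Δ)` -/

section SqrtDelta

theorem exists_sqrt_eq_or_neg {D : ℂ} {s : ℂ} (hs : s ^ 2 = D) :
    Complex.sqrt D = s ∨ Complex.sqrt D = -s := by
  apply sq_eq_sq_iff_eq_or_eq_neg.mp
  rw [hs, Complex.sqrt]
  exact Complex.cpow_nat_inv_pow D two_ne_zero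

theorem sqrt_sq (D : ℂ) : Complex.sqrt D ^ 2 = D :=
  Complex.cpow_nat_inv_pow D two_ne_zero

variable {n : ℕ}

theorem prime_of_mem_oddPrimes {p : ℕ} (h : p ∈ oddPrimes n) : p.Prime :=
  Nat.prime_of_mem_primeFactors (Finset.mem_of_mem_erase h)

theorem dvd_of_mem_oddPrimes {p : ℕ} (h : p ∈ oddPrimes n) : p ∣ n :=
  Nat.dvd_of_mem_primeFactors (Finset.mem_of_mem_erase h)

theorem ne_two_of_mem_oddPrimes {p : ℕ} (h : p ∈ oddPrimes n) : p ≠ 2 :=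
  Finset.ne_of_mem_erase h

theorem Exponents.natAbs_delta (E : Exponents n) :
    E.delta.natAbs = 2 ^ (E.w₀ : ℕ) * ∏ p : oddPrimes n, (p : ℕ) ^ (E.e p : ℕ) := by
  simp only [Exponents.delta, Int.natAbs_mul, Int.natAbs_pow]
  rw [← Int.natAbsHom_apply (∏ _, _), map_prod]
  simp [Int.natAbs_mul, Int.natAbs_pow]

theorem squarefree_pow_fin_two {a : ℕ} (ha : Squarefree a) (i : Fin 2) :
    Squarefree (a ^ (i : ℕ)) := by
  fin_cases i <;> simp [ha]

theorem Exponents.squarefree_delta (E : Exponents n) : Squarefree E.delta := by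
  rw [← Int.squarefree_natAbs, E.natAbs_delta, Nat.squarefree_mul_iff]
  refine ⟨Nat.Coprime.prod_right fun p _ => ?_,
    squarefree_pow_fin_two Nat.prime_two.prime.squarefree _, ?_⟩
  · exact Nat.Coprime.pow _ _ ((Nat.coprime_primes Nat.prime_two (prime_of_mem_oddPrimes p.2)).mpr
      (ne_two_of_mem_oddPrimes p.2).symm)
  · refine Finset.squarefree_prod_of_pairwise_isCoprime ?_ fun p _ =>
      squarefree_pow_fin_two (prime_of_mem_oddPrimes p.2).prime.squarefree _
    intro p _ q _ hpq
    exact Nat.coprime_iff_isRelPrime.mp (Nat.Coprime.pow _ _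
      ((Nat.coprime_primes (prime_of_mem_oddPrimes p.2) (prime_of_mem_oddPrimes q.2)).mpr
        fun h => hpq (Subtype.ext h)))

theorem Exponents.delta_ne_zero (E : Exponents n) : E.delta ≠ 0 := E.squarefree_delta.ne_zero

theorem Exponents.dvd_eight (E : Exponents n) (h : E.w₀ ≠ 0) : 8 ∣ n :=
  dvd_of_factorization (a := 3) (not_lt.mp fun h3 => h (E.w₀_eq_zero h3))

theorem Exponents.dvd_four (E : Exponents n) (h : E.w ≠ 0) : 4 ∣ n :=
  dvd_of_factorization (a := 2) (not_lt.mp fun h3 => h (E.w_eq_zero h3))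

/-- The quadratic character of `(ℤ / n)ˣ` with kernel `H_Δ`. -/
def Exponents.chi (E : Exponents n) (k : (ZMod n)ˣ) : ℤ := E.symb ((k : ZMod n).cast : ℤ)

theorem Exponents.mem_H {E : Exponents n} {k : (ZMod n)ˣ} : k ∈ E.H ↔ E.chi k = 1 := Iff.rfl

theorem Exponents.chi_mul (E : Exponents n) (k l : (ZMod n)ˣ) :
    E.chi (k * l) = E.chi k * E.chi l := E.symb_cast_mul _ _

theorem coprime_val_of_dvd {d : ℕ} (hd : d ∣ n) (k : (ZMod n)ˣ) : (k : ZMod n).val.Coprime d :=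
  (ZMod.val_coe_unit_coprime k).coprime_dvd_right hd

variable [NeZero n]

theorem exists_primitiveRoot_cyclo {d : ℕ} (hd : d ∣ n) :
    ∃ ζ : cyclo n, IsPrimitiveRoot ζ d ∧
      ∀ k, gal n k ζ = ζ ^ (k : ZMod n).val := by
  obtain ⟨c, hc⟩ := hd
  have hζ := IsCyclotomicExtension.zeta_spec n ℚ (cyclo n)
  refine ⟨IsCyclotomicExtension.zeta n ℚ (cyclo n) ^ c, hζ.pow (NeZero.pos n) (by rw [hc, mul_comm]),
    fun k => gal_apply_of_pow_eq_one k ?_⟩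
  rw [← pow_mul, mul_comm, pow_mul, hζ.pow_eq_one, one_pow]

/-- A root of `D` is needed only when the exponent is nonzero; this is what lets the conditions `m ≥
3` and `m ≥ 2` supply the 8th and 4th roots of unity exactly when they are used. -/
theorem exists_sq_eq_pow {D : ℤ} {t : (ZMod n)ˣ → ℤ} (i : Fin 2)
    (h : i ≠ 0 → ∃ s : cyclo n, s ^ 2 = (D : cyclo n) ∧ ∀ k, gal n k s = (t k : cyclo n) * s) :
    ∃ s : cyclo n, s ^ 2 = ((D ^ (i : ℕ) : ℤ) : cyclo n) ∧
      ∀ k, gal n k s = ((t k ^ (i : ℕ) : ℤ) : cyclo n) * s := by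
  fin_cases i
  · exact ⟨1, by simp, by simp⟩
  · simpa using h (by simp)

theorem Exponents.exists_sq_eq_delta (E : Exponents n) :
    ∃ s : cyclo n, s ^ 2 = (E.delta : cyclo n) ∧ ∀ k, gal n k s = (E.chi k : cyclo n) * s := by
  have hcast : ∀ k : (ZMod n)ˣ, ((k : ZMod n).cast : ℤ) = ((k : ZMod n).val : ℤ) :=
    fun k => (ZMod.natCast_val _).symm
  have h8 := exists_sq_eq_pow (n := n) (D := 2)
    (t := fun k => ZMod.χ₈ (((k : ZMod n).cast : ℤ) : ZMod 8)) E.w₀ (by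
      intro hw
      have h8n := E.dvd_eight hw
      obtain ⟨ζ, hζ, hk⟩ := exists_primitiveRoot_cyclo h8n
      obtain ⟨s, hs, hσ⟩ := exists_sq_eq_two_of_primitiveRoot hζ
      refine ⟨s, by simpa using hs, fun k => ?_⟩
      simp only [hcast]
      exact hσ ((gal n k : cyclo n ≃+* cyclo n) : cyclo n →+* cyclo n) _
        (coprime_val_of_dvd ((by norm_num : 2 ∣ 8).trans h8n) k) (hk k))
  have h4 := exists_sq_eq_pow (n := n) (D := -1)
    (t := fun k => ZMod.χ₄ (((k : ZMod n).cast : ℤ) : ZMod 4)) E.w (by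
      intro hw
      have h4n := E.dvd_four hw
      obtain ⟨ζ, hζ, hk⟩ := exists_primitiveRoot_cyclo h4n
      obtain ⟨hs, hσ⟩ := sq_neg_one_of_primitiveRoot hζ
      refine ⟨ζ, by simpa using hs, fun k => ?_⟩
      simp only [hcast]
      exact hσ ((gal n k : cyclo n ≃+* cyclo n) : cyclo n →+* cyclo n) _
        (coprime_val_of_dvd ((by norm_num : 2 ∣ 4).trans h4n) k) (hk k))
  have hp := fun p : oddPrimes n => exists_sq_eq_pow (n := n)
    (D := (-1) ^ (((p : ℕ) - 1) / 2) * ((p : ℕ) : ℤ))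
    (t := fun k => J(((k : ZMod n).cast : ℤ) | (p : ℕ))) (E.e p) (by
      intro _
      obtain ⟨ζ, hζ, hk⟩ := exists_primitiveRoot_cyclo (dvd_of_mem_oddPrimes p.2)
      obtain ⟨s, hs, hσ⟩ := exists_sq_eq_of_primitiveRoot_prime (prime_of_mem_oddPrimes p.2)
        (ne_two_of_mem_oddPrimes p.2) hζ
      refine ⟨s, hs, fun k => ?_⟩
      simp only [hcast]
      exact hσ ((gal n k : cyclo n ≃+* cyclo n) : cyclo n →+* cyclo n) _
        (coprime_val_of_dvd (dvd_of_mem_oddPrimes p.2) k) (hk k))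
  obtain ⟨a, ha, ha'⟩ := h8
  obtain ⟨b, hb, hb'⟩ := h4
  choose c hc hc' using hp
  refine ⟨a * b * ∏ p, c p, ?_, fun k => ?_⟩
  · rw [mul_pow, mul_pow, ← Finset.prod_pow, ha, hb, Finset.prod_congr rfl fun p _ => hc p,
      Exponents.delta]
    push_cast
    rfl
  · rw [map_mul, map_mul, map_prod, ha', hb', Finset.prod_congr rfl fun p _ => hc' p k,
      Finset.prod_mul_distrib, Exponents.chi, Exponents.symb]
    push_cast
    ring

/-- Both square roots of `Δ` transform by the same character, so the principal one may be taken. -/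
theorem Exponents.exists_sqrt_delta (E : Exponents n) :
    ∃ s : cyclo n, (s : ℂ) = Complex.sqrt (E.delta : ℂ) ∧ s ^ 2 = (E.delta : cyclo n) ∧
      ∀ k, gal n k s = (E.chi k : cyclo n) * s := by
  obtain ⟨s, hs, hσ⟩ := E.exists_sq_eq_delta
  have h2 : (s : ℂ) ^ 2 = (E.delta : ℂ) := by
    have := congrArg (algebraMap (cyclo n) ℂ) hs
    simpa using this
  rcases exists_sqrt_eq_or_neg h2 with h | h
  · exact ⟨s, h.symm, hs, hσ⟩
  · exact ⟨-s, by simp [h], by rw [neg_sq, hs], fun k => by rw [map_neg, hσ]; ring⟩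

/-- Apply `σ_k` to `s ^ 2 = Δ` and cancel `Δ`. -/
theorem Exponents.chi_sq (E : Exponents n) (k : (ZMod n)ˣ) : E.chi k ^ 2 = 1 := by
  obtain ⟨s, -, hs, hσ⟩ := E.exists_sqrt_delta
  have h := congrArg (gal n k) hs
  rw [map_pow, hσ, mul_pow, hs, map_intCast] at h
  have hD : (E.delta : cyclo n) ≠ 0 := by exact_mod_cast E.delta_ne_zero
  have := mul_right_cancel₀ hD (h.trans (one_mul _).symm)
  exact_mod_cast this

theorem Exponents.chi_eq_neg_one {E : Exponents n} {k : (ZMod n)ˣ} (h : k ∉ E.H) :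
    E.chi k = -1 :=
  (Int.isUnit_iff.mp (IsUnit.of_mul_eq_one _ ((sq _).symm.trans (E.chi_sq k)))).resolve_left h

theorem Exponents.chi_inv (E : Exponents n) (k : (ZMod n)ˣ) : E.chi k⁻¹ = E.chi k := by
  have h := E.chi_mul k k⁻¹
  have h1 : E.chi 1 = 1 := E.symb_cast_one
  rw [mul_inv_cancel, h1] at h
  have h2 := E.chi_sq k
  calc E.chi k⁻¹ = E.chi k ^ 2 * E.chi k⁻¹ := by rw [h2, one_mul]
    _ = E.chi k * (E.chi k * E.chi k⁻¹) := by ring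
    _ = E.chi k := by rw [← h, mul_one]

/-- If `q ^ 2 D` is an integer with `D` squarefree, then the rational `q` is an integer. -/
theorem exists_int_of_sq_mul_squarefree {D m : ℤ} (hD : Squarefree D) {q : ℚ}
    (h : q ^ 2 * D = m) : ∃ a : ℤ, q = a := by
  have hd : (q.den : ℚ) ≠ 0 := by exact_mod_cast q.den_nz
  have h1 : q.num ^ 2 * D = m * (q.den : ℤ) ^ 2 := by
    have h2 : ((q.num : ℚ) / q.den) ^ 2 * D = m := by rw [Rat.num_div_den, h]
    field_simp at h2
    rw [mul_comm m]
    exact_mod_cast h2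
  have hcop : IsCoprime ((q.den : ℤ) ^ 2) (q.num ^ 2) :=
    (Int.isCoprime_iff_gcd_eq_one.mpr (by
      have := q.reduced
      simpa [Int.gcd, Nat.coprime_comm] using this)).pow
  have h3 : (q.den : ℤ) * q.den ∣ D := by
    rw [← sq]
    exact hcop.dvd_of_dvd_mul_left (Dvd.intro_left _ h1.symm)
  have h4 : q.den = 1 := by
    have := Int.isUnit_iff_natAbs_eq.mp (hD _ h3)
    simpa using this
  exact ⟨q.num, (Rat.den_eq_one_iff q).mp h4 |>.symm⟩

/-- If `χ_Δ` is trivial then `√Δ` is Galois-fixed, hence rational, and a square-free integer that is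
a rational square equals 1. -/
theorem Exponents.delta_eq_one_iff (E : Exponents n) : E.delta = 1 ↔ ∀ k, k ∈ E.H := by
  obtain ⟨s, hs, hs2, hσ⟩ := E.exists_sqrt_delta
  constructor
  · intro h k
    rw [h] at hs
    have h1 : s = 1 := Subtype.ext (by simpa using hs)
    have h2 := hσ k
    rw [h1, map_one, mul_one] at h2
    rw [mem_H]
    exact_mod_cast h2.symm
  · intro h
    obtain ⟨q, hq⟩ := exists_rat_of_gal_fixed (x := s) fun k => by
      rw [hσ k, mem_H.mp (h k), Int.cast_one, one_mul]
    have h2 : q ^ 2 = (E.delta : ℚ) := by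
      have := sqrt_sq (E.delta : ℂ)
      rw [← hs, hq] at this
      exact_mod_cast this
    obtain ⟨a, rfl⟩ := exists_int_of_sq_mul_squarefree (D := 1) squarefree_one
      (m := E.delta) (by simpa using h2)
    have h3 : a ^ 2 = E.delta := by exact_mod_cast h2
    have h4 : IsUnit a := E.squarefree_delta a (by rw [← h3, sq])
    rw [← h3]
    rcases Int.isUnit_iff.mp h4 with rfl | rfl <;> norm_num

theorem Exponents.exists_notMem_H {E : Exponents n} (h : E.delta ≠ 1) : ∃ k, k ∉ E.H := by
  by_contra! hc
  exact h (E.delta_eq_one_iff.mpr hc)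

theorem Exponents.index_H {E : Exponents n} (h : E.delta ≠ 1) : E.H.index = 2 := by
  obtain ⟨a, ha⟩ := exists_notMem_H h
  rw [Subgroup.index_eq_two_iff]
  refine ⟨a, fun b => ?_⟩
  simp only [mem_H, E.chi_mul, chi_eq_neg_one ha]
  by_cases hb : E.chi b = 1
  · simp [hb]
  · simp [chi_eq_neg_one (show b ∉ E.H from hb)]

theorem sqrt_mem_quadField (D : ℤ) : Complex.sqrt (D : ℂ) ∈ quadField D :=
  IntermediateField.mem_adjoin_simple_self ℚ _

/-- The product `x √Δ` is Galois-fixed, because `χ_Δ ^ 2 = 1`. -/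
theorem Exponents.exists_rat_mul_sqrt {E : Exponents n} {x : cyclo n}
    (h : ∀ k, gal n k x = (E.chi k : cyclo n) * x) :
    ∃ q : ℚ, (x : ℂ) = q * Complex.sqrt (E.delta : ℂ) := by
  obtain ⟨s, hs, hs2, hσ⟩ := E.exists_sqrt_delta
  obtain ⟨q, hq⟩ := exists_rat_of_gal_fixed (x := x * s) fun k => by
    have h2 : (E.chi k : cyclo n) ^ 2 = 1 := by exact_mod_cast E.chi_sq k
    rw [map_mul, h, hσ]
    linear_combination x * s * h2
  have hD : (E.delta : ℂ) ≠ 0 := by exact_mod_cast E.delta_ne_zero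
  refine ⟨q / E.delta, ?_⟩
  push_cast at hq ⊢
  rw [← hq, hs]
  field_simp
  rw [sqrt_sq]

theorem Exponents.exists_rat_add_rat_mul_sqrt {E : Exponents n} {x : cyclo n}
    (h : ∀ k ∈ E.H, gal n k x = x) :
    ∃ q r : ℚ, (x : ℂ) = q + r * Complex.sqrt (E.delta : ℂ) := by
  by_cases hD : E.delta = 1
  · obtain ⟨q, hq⟩ := exists_rat_of_gal_fixed fun k => h k (E.delta_eq_one_iff.mp hD k)
    exact ⟨q, 0, by simp [hq]⟩
  -- With `a` in the nontrivial coset of `H_Δ`, the sum `x + σ_a x` is fixed by everything and `x -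
  -- σ_a x` transforms by `χ_Δ`; half of each gives the two components of `x`.
  · obtain ⟨a, ha⟩ := exists_notMem_H hD
    have hout : ∀ k, k ∉ E.H → gal n k x = gal n a x := by
      intro k hk
      have h1 : a⁻¹ * k ∈ E.H := by
        rw [mem_H, E.chi_mul, E.chi_inv, chi_eq_neg_one ha, chi_eq_neg_one hk]
        norm_num
      have h2 : k = a * (a⁻¹ * k) := by group
      conv_lhs => rw [h2, map_mul, AlgEquiv.mul_apply, h _ h1]
    have haa : gal n a (gal n a x) = x := by
      rw [← AlgEquiv.mul_apply, ← map_mul]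
      refine h _ ?_
      rw [mem_H, E.chi_mul, chi_eq_neg_one ha]
      norm_num
    have hout2 : ∀ k, k ∉ E.H → gal n k (gal n a x) = x := by
      intro k hk
      rw [← AlgEquiv.mul_apply, ← map_mul]
      refine h _ ?_
      rw [mem_H, E.chi_mul, chi_eq_neg_one ha, chi_eq_neg_one hk]
      norm_num
    have hin : ∀ k ∈ E.H, gal n k (gal n a x) = gal n a x := by
      intro k hk
      rw [← AlgEquiv.mul_apply, ← map_mul]
      refine hout _ ?_
      rw [mem_H, E.chi_mul, mem_H.mp hk, chi_eq_neg_one ha]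
      norm_num
    obtain ⟨q, hq⟩ := exists_rat_of_gal_fixed (x := x + gal n a x) fun k => by
      rw [map_add]
      by_cases hk : k ∈ E.H
      · rw [h k hk, hin k hk]
      · rw [hout k hk, hout2 k hk, add_comm]
    obtain ⟨r, hr⟩ := E.exists_rat_mul_sqrt (x := x - gal n a x) fun k => by
      rw [map_sub]
      by_cases hk : k ∈ E.H
      · rw [h k hk, hin k hk, mem_H.mp hk, Int.cast_one, one_mul]
      · rw [hout k hk, hout2 k hk, chi_eq_neg_one hk]
        push_cast
        ring
    refine ⟨q / 2, r / 2, ?_⟩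
    push_cast at hq hr ⊢
    linear_combination (hq + hr) / 2

/-- The elements of the `n`-th cyclotomic field that lie in `ℚ(√Δ)` are those fixed by `H_Δ`. -/
theorem Exponents.mem_quadField_iff {E : Exponents n} {x : cyclo n} :
    (x : ℂ) ∈ quadField E.delta ↔ ∀ k ∈ E.H, gal n k x = x := by
  obtain ⟨s, hs, hs2, hσ⟩ := E.exists_sqrt_delta
  constructor
  · intro hx k hk
    let F : IntermediateField ℚ (cyclo n) :=
      IntermediateField.fixedField (Subgroup.zpowers (gal n k))
    have hF : quadField E.delta ≤ F.map (cyclo n).val := by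
      refine IntermediateField.adjoin_le_iff.mpr ?_
      rintro _ rfl
      refine ⟨s, ?_, hs⟩
      have key : gal n k s = s := by rw [hσ, mem_H.mp hk, Int.cast_one, one_mul]
      rintro ⟨f, hf⟩
      have hle : Subgroup.zpowers (gal n k) ≤ MulAction.stabilizer _ s :=
        Subgroup.zpowers_le.mpr (MulAction.mem_stabilizer_iff.mpr key)
      exact hle hf
    obtain ⟨y, hy, hyx⟩ := hF hx
    have : y = x := Subtype.ext hyx
    subst this
    exact hy ⟨gal n k, Subgroup.mem_zpowers _⟩
  · intro h
    obtain ⟨q, r, hx⟩ := E.exists_rat_add_rat_mul_sqrt h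
    rw [hx]
    exact add_mem ((quadField E.delta).algebraMap_mem q)
      (mul_mem ((quadField E.delta).algebraMap_mem r) (sqrt_mem_quadField _))

end SqrtDelta

/-! ### Which square-free `D` have `√D` in the `n`-th cyclotomic field -/

section Level

theorem exists_unit_modEq {q m r : ℕ} (h : q.Coprime m) (hr : r.Coprime q) :
    ∃ k : (ZMod (q * m))ˣ, (k : ZMod (q * m)).val ≡ r [MOD q] ∧
      (k : ZMod (q * m)).val ≡ 1 [MOD m] := by
  obtain ⟨k, hkq, hkm⟩ := Nat.chineseRemainder h r 1
  have hk : k.Coprime (q * m) :=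
    Nat.Coprime.mul_right (by rw [Nat.Coprime, hkq.gcd_eq]; exact hr)
      (by rw [Nat.Coprime, hkm.gcd_eq]; exact Nat.gcd_one_left m)
  refine ⟨ZMod.unitOfCoprime k hk, ?_, ?_⟩ <;>
    rw [ZMod.coe_unitOfCoprime, ZMod.val_natCast]
  · exact ((Nat.mod_modEq k (q * m)).of_mul_right m).trans hkq
  · exact ((Nat.mod_modEq k (q * m)).of_mul_left q).trans hkm

variable {N : ℕ} [NeZero N]

theorem Exponents.chi_eq_symb_val (E : Exponents N) (k : (ZMod N)ˣ) :
    E.chi k = E.symb ((k : ZMod N).val : ℤ) := by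
  rw [ZMod.natCast_val]
  rfl

theorem jacobiSym_of_modEq {p a b : ℕ} (h : a ≡ b [MOD p]) : J((a : ℤ) | p) = J((b : ℤ) | p) :=
  jacobiSym.mod_left' (by exact_mod_cast h)

theorem intCast_zmod_of_modEq {p a b : ℕ} (h : a ≡ b [MOD p]) :
    (((a : ℤ)) : ZMod p) = ((b : ℤ) : ZMod p) := by
  simpa using (ZMod.natCast_eq_natCast_iff a b p).mpr h

/-- If `√Δ` lies in the `n`-th cyclotomic field, with `n ∣ N`, then `χ_Δ` is trivial on the residues
modulo `N` that are `1` modulo `n`. -/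
theorem Exponents.chi_eq_one_of_modEq {n : ℕ} (h : n ∣ N) (E : Exponents N)
    (hs : Complex.sqrt (E.delta : ℂ) ∈ cyclo n) {k : (ZMod N)ˣ}
    (hk : (k : ZMod N).val ≡ 1 [MOD n]) : E.chi k = 1 := by
  obtain ⟨s, hs1, hs2, hσ⟩ := E.exists_sqrt_delta
  have h1 := gal_fixes_cyclo_of_dvd h k hk (x := s) (by rwa [hs1])
  have hs0 : s ≠ 0 := by
    rintro rfl
    have : (E.delta : cyclo N) ≠ 0 := by exact_mod_cast E.delta_ne_zero
    exact this (by rw [← hs2]; simp)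
  rw [hσ] at h1
  have := mul_right_cancel₀ hs0 (h1.trans (one_mul s).symm)
  exact_mod_cast this

/-- If `p ∤ n`, take `k` a non-residue modulo `p` and 1 modulo the prime-to-`p` part of `N`. It is 1
modulo `n`, so `χ_Δ(k) = 1`, yet only the factor at `p` contributes and it is `-1`. -/
theorem Exponents.prime_dvd_of_sqrt_mem_cyclo {n : ℕ} (h : n ∣ N) (h8 : 8 ∣ N) (E : Exponents N)
    (hs : Complex.sqrt (E.delta : ℂ) ∈ cyclo n) (p : oddPrimes N) (hp : E.e p ≠ 0) :
    (p : ℕ) ∣ n := by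
  by_contra hpn
  have hprime := prime_of_mem_oddPrimes p.2
  have hp2 := ne_two_of_mem_oddPrimes p.2
  have : Fact (p : ℕ).Prime := ⟨hprime⟩
  obtain ⟨q, m, hqm, hN, a, hq, ha⟩ : ∃ q m : ℕ, q.Coprime m ∧ q * m = N ∧
      ∃ a, q = (p : ℕ) ^ a ∧ a ≠ 0 :=
    ⟨_, _, (Nat.coprime_ordCompl hprime (NeZero.ne N)).pow_left _,
      Nat.ordProj_mul_ordCompl_eq_self N p, _, rfl,
      (hprime.factorization_pos_of_dvd (NeZero.ne N) (dvd_of_mem_oddPrimes p.2)).ne'⟩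
  subst hN
  have hcop : ∀ d : ℕ, d.Coprime p → d.Coprime q := by
    intro d hd
    rw [hq]
    exact hd.pow_right a
  have hm : ∀ d : ℕ, d.Coprime p → d ∣ q * m → d ∣ m := fun d hd hdN =>
    (hcop d hd).dvd_of_dvd_mul_left hdN
  have hpq : (p : ℕ) ∣ q := (dvd_pow_self _ ha).trans hq.symm.dvd
  obtain ⟨u, hu⟩ := quadraticChar_exists_neg_one' (F := ZMod p) (by rwa [ZMod.ringChar_zmod_n])
  have hup : (u : ZMod p).val.Coprime p := ZMod.val_coe_unit_coprime u
  obtain ⟨k, hkq, hkm⟩ := exists_unit_modEq hqm (hcop _ hup)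
  have h1 := E.chi_eq_one_of_modEq h hs
    (hkm.of_dvd (hm n ((Nat.Prime.coprime_iff_not_dvd hprime).mpr hpn).symm h))
  have h8m : 8 ∣ m := hm 8 (Nat.Coprime.pow_left 3
    ((Nat.coprime_primes Nat.prime_two hprime).mpr hp2.symm)) h8
  rw [E.chi_eq_symb_val, Exponents.symb, Fintype.prod_eq_single p,
    intCast_zmod_of_modEq (hkm.of_dvd h8m),
    intCast_zmod_of_modEq (hkm.of_dvd ((by norm_num : 4 ∣ 8).trans h8m)),
    jacobiSym_of_modEq (hkq.of_dvd hpq), ← jacobiSym.legendreSym.to_jacobiSym, legendreSym] at h1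
  · have he : (E.e p : ℕ) = 1 := by
      have := (E.e p).isLt
      have h0 : (E.e p : ℕ) ≠ 0 := fun h => hp (Fin.ext h)
      omega
    simp [he, hu] at h1
  · intro q' hq'
    have hq'm : (q' : ℕ) ∣ m := hm q' ((Nat.coprime_primes (prime_of_mem_oddPrimes q'.2) hprime).mpr
      fun h => hq' (Subtype.ext h)) (dvd_of_mem_oddPrimes q'.2)
    rw [jacobiSym_of_modEq (hkm.of_dvd hq'm)]
    simp

/-- Lift `r` to a unit that is 1 modulo the odd part of `N`. As the 2-part of `n` divides `2 ^ b`,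
the lift is 1 modulo `n`, so `χ_Δ` is 1 there; the odd primes contribute nothing. -/
theorem Exponents.two_part_symb_eq_one {r : ℕ} (hr : r.Coprime 2) (h8 : 8 ∣ N)
    (E : Exponents N) {n b : ℕ} (h : n ∣ N) (hb : ¬ 2 ^ (b + 1) ∣ n) (hb3 : b ≤ 3)
    (hrb : r ≡ 1 [MOD 2 ^ b]) (hs : Complex.sqrt (E.delta : ℂ) ∈ cyclo n) :
    ZMod.χ₈ ((r : ℤ) : ZMod 8) ^ (E.w₀ : ℕ) * ZMod.χ₄ ((r : ℤ) : ZMod 4) ^ (E.w : ℕ) = 1 := by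
  obtain ⟨q, m, hqm, hN, a, hq, ha⟩ : ∃ q m : ℕ, q.Coprime m ∧ q * m = N ∧
      ∃ a, q = 2 ^ a ∧ 3 ≤ a :=
    ⟨_, _, (Nat.coprime_ordCompl Nat.prime_two (NeZero.ne N)).pow_left _,
      Nat.ordProj_mul_ordCompl_eq_self N 2, _, rfl,
      (Nat.prime_two.pow_dvd_iff_le_factorization (NeZero.ne N)).mp h8⟩
  subst hN
  have hcop : ∀ d : ℕ, d.Coprime 2 → d.Coprime q := fun d hd => hq ▸ hd.pow_right a
  obtain ⟨k, hkq, hkm⟩ := exists_unit_modEq hqm (hcop r hr)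
  have h8q : 8 ∣ q := hq ▸ pow_dvd_pow 2 ha
  have hbq : 2 ^ b ∣ q := hq ▸ pow_dvd_pow 2 (hb3.trans ha)
  have hn : n ∣ 2 ^ b * m := by
    obtain ⟨x, y, hx, hy, rfl⟩ := exists_dvd_and_dvd_of_dvd_mul h
    rw [hq] at hx
    obtain ⟨c, -, rfl⟩ := (Nat.dvd_prime_pow Nat.prime_two).mp hx
    refine Nat.mul_dvd_mul (pow_dvd_pow 2 ?_) hy
    by_contra hc
    exact hb ((pow_dvd_pow 2 (by omega)).trans (Nat.dvd_mul_right _ _))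
  have hk1 : (k : ZMod (q * m)).val ≡ 1 [MOD 2 ^ b * m] :=
    (Nat.modEq_and_modEq_iff_modEq_mul (hqm.coprime_dvd_left hbq)).mp
      ⟨(hkq.of_dvd hbq).trans hrb, hkm⟩
  have h1 := E.chi_eq_one_of_modEq h hs (hk1.of_dvd hn)
  rw [E.chi_eq_symb_val, Exponents.symb, Fintype.prod_eq_one,
    intCast_zmod_of_modEq (hkq.of_dvd h8q),
    intCast_zmod_of_modEq (hkq.of_dvd ((by norm_num : 4 ∣ 8).trans h8q)), mul_one] at h1
  · exact h1
  · intro p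
    have hpm : (p : ℕ) ∣ m := by
      refine Nat.Coprime.dvd_of_dvd_mul_left ?_ (dvd_of_mem_oddPrimes p.2)
      exact hcop _ ((Nat.coprime_primes (prime_of_mem_oddPrimes p.2)
        Nat.prime_two).mpr (ne_two_of_mem_oddPrimes p.2))
    rw [jacobiSym_of_modEq (hkm.of_dvd hpm)]
    simp

theorem Exponents.eight_dvd_of_sqrt_mem_cyclo {n : ℕ} (h : n ∣ N) (h8 : 8 ∣ N) (E : Exponents N)
    (hs : Complex.sqrt (E.delta : ℂ) ∈ cyclo n) (hw : E.w₀ ≠ 0) : 8 ∣ n := by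
  by_contra hn
  -- The residue 5 is 1 modulo 4 and has `χ₈ = -1`, `χ₄ = 1`, so it detects `w₀` whatever `w` is.
  have h1 := E.two_part_symb_eq_one (r := 5) (by norm_num) h8 h (b := 2) hn (by norm_num)
    (by decide) hs
  have hχ8 : ZMod.χ₈ (((5 : ℕ) : ℤ) : ZMod 8) = -1 := by decide
  have hχ4 : ZMod.χ₄ (((5 : ℕ) : ℤ) : ZMod 4) = 1 := by decide
  have hw1 : E.w₀ = 1 := by omega
  rw [hχ8, hχ4, hw1] at h1
  norm_num at h1

theorem Exponents.four_dvd_of_sqrt_mem_cyclo {n : ℕ} (h : n ∣ N) (h8 : 8 ∣ N) (E : Exponents N)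
    (hs : Complex.sqrt (E.delta : ℂ) ∈ cyclo n) (hw : E.w ≠ 0) : 4 ∣ n := by
  by_contra hn
  -- The residue 7 has `χ₈ = 1`, `χ₄ = -1`, so it detects `w` whatever `w₀` is.
  have h1 := E.two_part_symb_eq_one (r := 7) (by norm_num) h8 h (b := 1) hn (by norm_num)
    (by decide) hs
  have hχ8 : ZMod.χ₈ (((7 : ℕ) : ℤ) : ZMod 8) = 1 := by decide
  have hχ4 : ZMod.χ₄ (((7 : ℕ) : ℤ) : ZMod 4) = -1 := by decide
  have hw1 : E.w = 1 := by omega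
  rw [hχ8, hχ4, hw1] at h1
  norm_num at h1

omit [NeZero N] in
theorem mem_oddPrimes {p : ℕ} : p ∈ oddPrimes N ↔ p ≠ 2 ∧ p.Prime ∧ p ∣ N ∧ N ≠ 0 := by
  rw [oddPrimes, Finset.mem_erase, Nat.mem_primeFactors]

theorem mem_oddPrimes_of_dvd {n : ℕ} (h : n ∣ N) {p : ℕ} (hp : p ∈ oddPrimes n) :
    p ∈ oddPrimes N :=
  mem_oddPrimes.mpr ⟨ne_two_of_mem_oddPrimes hp, prime_of_mem_oddPrimes hp,
    (dvd_of_mem_oddPrimes hp).trans h, NeZero.ne N⟩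

theorem Exponents.exists_delta_eq_of_sqrt_mem_cyclo {n : ℕ} (h : n ∣ N) (h8 : 8 ∣ N)
    (E : Exponents N) (hs : Complex.sqrt (E.delta : ℂ) ∈ cyclo n) :
    ∃ F : Exponents n, E.delta = F.delta := by
  have hn0 : n ≠ 0 := fun h0 => NeZero.ne N (by simpa [h0] using h)
  refine ⟨⟨E.w₀, E.w, fun p => E.e ⟨p, mem_oddPrimes_of_dvd h p.2⟩, fun hlt => ?_, fun hlt => ?_⟩, ?_⟩
  · by_contra hw
    exact hlt.not_ge ((Nat.prime_two.pow_dvd_iff_le_factorization hn0).mp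
      (E.eight_dvd_of_sqrt_mem_cyclo h h8 hs hw))
  · by_contra hw
    exact hlt.not_ge ((Nat.prime_two.pow_dvd_iff_le_factorization hn0).mp
      (E.four_dvd_of_sqrt_mem_cyclo h h8 hs hw))
  · simp only [Exponents.delta]
    congr 1
    symm
    refine Fintype.prod_of_injective
      (fun p : oddPrimes n => (⟨p, mem_oddPrimes_of_dvd h p.2⟩ : oddPrimes N))
      (fun p q hpq => Subtype.ext (congrArg (fun x : oddPrimes N => (x : ℕ)) hpq)) _ _ (fun p hp => ?_)
      fun p => rfl
    have he : E.e p = 0 := by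
      by_contra he
      exact hp ⟨⟨p, mem_oddPrimes.mpr ⟨ne_two_of_mem_oddPrimes p.2, prime_of_mem_oddPrimes p.2,
        E.prime_dvd_of_sqrt_mem_cyclo h h8 hs p he, hn0⟩⟩, rfl⟩
    simp [he]

/-- The prime divisors of `D` dictate all exponents except `w`. The absolute value does not involve
`w`, which is then chosen to correct the sign. -/
theorem exists_exponents_of_dvd {D : ℤ} (hD : Squarefree D) (h : D.natAbs ∣ N) (h8 : 8 ∣ N) :
    ∃ E : Exponents N, E.delta = D := by
  have h3 : 3 ≤ N.factorization 2 :=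
    (Nat.prime_two.pow_dvd_iff_le_factorization (NeZero.ne N)).mp h8
  let F : Fin 2 → Exponents N := fun w =>
    ⟨if 2 ∣ D.natAbs then 1 else 0, w, fun p => if (p : ℕ) ∣ D.natAbs then 1 else 0,
      fun hlt => by omega, fun hlt => by omega⟩
  have hsq := Int.squarefree_natAbs.mpr hD
  have hF : ∀ w, (F w).delta.natAbs = D.natAbs := by
    intro w
    rw [Exponents.natAbs_delta]
    have h1 : ∏ p : oddPrimes N, (p : ℕ) ^ ((F w).e p : ℕ) = ∏ p ∈ oddPrimes D.natAbs, p := by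
      rw [← Finset.prod_coe_sort (oddPrimes D.natAbs) (fun p : ℕ => p)]
      symm
      refine Fintype.prod_of_injective
        (fun p : oddPrimes D.natAbs => (⟨p, mem_oddPrimes_of_dvd h p.2⟩ : oddPrimes N))
        (fun p q hpq => Subtype.ext (congrArg (fun x : oddPrimes N => (x : ℕ)) hpq)) _ _ (fun p hp => ?_)
        fun p => ?_
      · have : ¬ (p : ℕ) ∣ D.natAbs := fun hd => hp ⟨⟨p, mem_oddPrimes.mpr
          ⟨ne_two_of_mem_oddPrimes p.2, prime_of_mem_oddPrimes p.2, hd, hsq.ne_zero⟩⟩, rfl⟩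
        simp [F, this]
      · simp [F, dvd_of_mem_oddPrimes p.2]
    rw [h1]
    conv_rhs => rw [← Nat.prod_primeFactors_of_squarefree hsq]
    by_cases h2 : 2 ∣ D.natAbs
    · have hm : 2 ∈ D.natAbs.primeFactors :=
        Nat.mem_primeFactors.mpr ⟨Nat.prime_two, h2, hsq.ne_zero⟩
      rw [← Finset.mul_prod_erase _ _ hm]
      simp [F, h2, oddPrimes]
    · have hm : 2 ∉ D.natAbs.primeFactors := fun hm => h2 (Nat.dvd_of_mem_primeFactors hm)
      rw [oddPrimes, Finset.erase_eq_of_notMem hm]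
      simp [F, h2]
  rcases Int.natAbs_eq_natAbs_iff.mp (hF 0) with h0 | h0
  · exact ⟨F 0, h0⟩
  · refine ⟨F 1, ?_⟩
    rw [← neg_eq_iff_eq_neg] at h0
    rw [← h0]
    simp [Exponents.delta, F]

/-- The quadratic subfields of the `n`-th cyclotomic field are the fields `ℚ(√Δ)`. -/
theorem exists_exponents_of_sqrt_mem_cyclo {n : ℕ} [NeZero n] {D : ℤ} (hD : Squarefree D)
    (hs : Complex.sqrt (D : ℂ) ∈ cyclo n) : ∃ E : Exponents n, D = E.delta := by
  have hD0 : D.natAbs ≠ 0 := Int.natAbs_ne_zero.mpr hD.ne_zero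
  -- At level `8|D|n` every exponent is admissible and `D` certainly has the form `Δ`; the previous
  -- lemmas then descend to level `n`.
  have : NeZero (8 * D.natAbs * n) :=
    ⟨mul_ne_zero (mul_ne_zero (by norm_num) hD0) (NeZero.ne n)⟩
  obtain ⟨E, hE⟩ := exists_exponents_of_dvd (N := 8 * D.natAbs * n) hD
    ((Nat.dvd_mul_left _ _).trans (Nat.dvd_mul_right _ _))
    ((Nat.dvd_mul_right _ _).trans (Nat.dvd_mul_right _ _))
  rw [← hE] at hs ⊢
  exact E.exists_delta_eq_of_sqrt_mem_cyclo (Nat.dvd_mul_left _ _)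
    ((Nat.dvd_mul_right _ _).trans (Nat.dvd_mul_right _ _)) hs

end Level

/-! ### Eigenvalues of matrices in the group scheme as character sums -/

section Circulant

variable {G : Type*} [AddCommGroup G]

/-- The matrix `∑ c(g) A_g`. -/
def weightedMatrix (c : G → ℤ) : Matrix G G ℂ := Matrix.of fun u v => (c (v - u) : ℂ)

variable [Fintype G]

/-- The character sum `∑ c(g) ψ(g)`. -/
noncomputable def charSum (c : G → ℤ) (ψ : AddChar G ℂ) : ℂ := ∑ g, (c g : ℂ) * ψ g

theorem eigenvalues_weightedMatrix [DecidableEq G] (c : G → ℤ) :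
    eigenvalues (weightedMatrix c) = Set.range (charSum c) := by
  classical
  let b := AddChar.complexBasis G
  have h : Matrix.toLin' (weightedMatrix c) =
      Matrix.toLin b b (Matrix.diagonal (charSum c)) := by
    refine b.ext fun ψ => ?_
    rw [Matrix.toLin_self]
    simp only [b, AddChar.complexBasis_apply, Matrix.diagonal_apply, ite_smul, zero_smul,
      Finset.sum_ite_eq', Finset.mem_univ, if_true]
    ext u
    rw [Matrix.toLin'_apply, Matrix.mulVec, dotProduct, Pi.smul_apply, smul_eq_mul, charSum,
      -- Substituting `v = g + u` splits `ψ(v)` as `ψ(g) ψ(u)`, so `ψ` is an eigenvector.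
      Finset.sum_mul, ← Equiv.sum_comp (Equiv.addRight u)]
    refine Finset.sum_congr rfl fun g _ => ?_
    simp [weightedMatrix, AddChar.map_add_eq_mul, mul_assoc]
  ext μ
  change Module.End.HasEigenvalue _ _ ↔ _
  rw [h, hasEigenvalue_toLin_diagonal_iff]
  rfl

/-- The characters form a basis of the functions on `G`, so a linear functional vanishing on all of
them is zero. -/
theorem charSum_injective : Function.Injective (charSum : (G → ℤ) → AddChar G ℂ → ℂ) := by
  classical
  intro c d h
  let f : (G → ℂ) →ₗ[ℂ] ℂ := Fintype.linearCombination ℂ (fun g => ((c g : ℂ) - d g))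
  have hf : f = 0 := by
    refine (AddChar.complexBasis G).ext fun ψ => ?_
    have := congrFun h ψ
    simp only [charSum] at this
    rw [AddChar.complexBasis_apply, Fintype.linearCombination_apply, LinearMap.zero_apply]
    simp only [smul_eq_mul, mul_comm (ψ _), sub_mul, Finset.sum_sub_distrib]
    rw [this, sub_self]
  funext g
  have h1 := congrArg (fun l => l (Pi.single g 1)) hf
  simp only [f, Fintype.linearCombination_apply_single, LinearMap.zero_apply, one_smul] at h1
  exact_mod_cast sub_eq_zero.mp h1

end Circulant

/-! ### Galois action on character sums, translated to coefficients -/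

section GaloisAction

variable {G : Type*} [AddCommGroup G] [Fintype G]

instance : NeZero (AddMonoid.exponent G) := ⟨AddMonoid.exponent_ne_zero_of_finite⟩

omit [Fintype G] in
theorem addChar_pow_exponent (ψ : AddChar G ℂ) (g : G) : ψ g ^ AddMonoid.exponent G = 1 := by
  rw [← AddChar.map_nsmul_eq_pow, AddMonoid.exponent_nsmul_eq_zero, AddChar.map_zero_eq_one]

/-- The character sum as an element of the cyclotomic field. -/
noncomputable def charSumCyclo (c : G → ℤ) (ψ : AddChar G ℂ) : cyclo (AddMonoid.exponent G) :=
  ∑ g, (c g : cyclo (AddMonoid.exponent G)) * ⟨ψ g, mem_cyclo_of_pow_eq_one (addChar_pow_exponent ψ g)⟩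

theorem coe_charSumCyclo (c : G → ℤ) (ψ : AddChar G ℂ) : (charSumCyclo c ψ : ℂ) = charSum c ψ := by
  rw [charSumCyclo, charSum, ← IntermediateField.algebraMap_apply, map_sum]
  refine Finset.sum_congr rfl fun g _ => ?_
  rw [map_mul, map_intCast]
  rfl

/-- Multiplication by a unit modulo the exponent, as a permutation of the group. -/
noncomputable def unitMulEquiv (k : (ZMod (AddMonoid.exponent G))ˣ) : G ≃ G where
  toFun := unitMul k
  invFun := unitMul k⁻¹
  left_inv g := by rw [← unitMul_mul, inv_mul_cancel, unitMul_one]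
  right_inv g := by rw [← unitMul_mul, mul_inv_cancel, unitMul_one]

omit [Fintype G] in
theorem unitMul_inv_unitMul (k : (ZMod (AddMonoid.exponent G))ˣ) (g : G) :
    unitMul k⁻¹ (unitMul k g) = g := (unitMulEquiv k).left_inv g

omit [Fintype G] in
theorem unitMul_unitMul_inv (k : (ZMod (AddMonoid.exponent G))ˣ) (g : G) :
    unitMul k (unitMul k⁻¹ g) = g := (unitMulEquiv k).right_inv g

theorem gal_charSumCyclo (k : (ZMod (AddMonoid.exponent G))ˣ) (c : G → ℤ) (ψ : AddChar G ℂ) :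
    gal _ k (charSumCyclo c ψ) = charSumCyclo (fun g => c (unitMul k⁻¹ g)) ψ := by
  rw [charSumCyclo, charSumCyclo, map_sum]
  refine (Finset.sum_congr rfl fun g _ => ?_).trans (Equiv.sum_comp (unitMulEquiv k) _)
  rw [map_mul, map_intCast, gal_apply_of_pow_eq_one k (Subtype.ext (addChar_pow_exponent ψ _))]
  have hg : c (unitMul k⁻¹ (unitMulEquiv k g)) = c g := congrArg c (unitMul_inv_unitMul k g)
  simp only [hg]
  congr 1
  refine Subtype.ext ?_
  change ψ g ^ _ = ψ (unitMul k g)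
  rw [← AddChar.map_nsmul_eq_pow, unitMul, ← ZMod.natCast_val, natCast_zsmul]

/-- Both sides are character sums, so `charSum_injective` applies. It is used with `a = 1` for (i)
and `a = χ_Δ(k)` for (ii). -/
theorem gal_charSumCyclo_eq_iff (k : (ZMod (AddMonoid.exponent G))ˣ) (c : G → ℤ) (a : ℤ) :
    (∀ ψ, gal _ k (charSumCyclo c ψ) = (a : cyclo _) * charSumCyclo c ψ) ↔
      ∀ g, c (unitMul k⁻¹ g) = a * c g := by
  have hmul : ∀ ψ, (a : cyclo _) * charSumCyclo c ψ = charSumCyclo (fun g => a * c g) ψ := by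
    intro ψ
    rw [charSumCyclo, charSumCyclo, Finset.mul_sum]
    refine Finset.sum_congr rfl fun g _ => ?_
    push_cast
    ring
  simp only [hmul, gal_charSumCyclo]
  constructor
  · intro h
    refine congrFun (charSum_injective (funext fun ψ => ?_))
    rw [← coe_charSumCyclo, h ψ, coe_charSumCyclo]
  · intro h ψ
    rw [funext h]

variable (E : Exponents (AddMonoid.exponent G)) (c : G → ℤ)

theorem charSum_mem_quadField_iff :
    (∀ ψ, charSum c ψ ∈ quadField E.delta) ↔ ∀ k ∈ E.H, ∀ g, c (unitMul k g) = c g := by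
  simp only [← coe_charSumCyclo, Exponents.mem_quadField_iff]
  constructor
  · intro h k hk g
    have := (gal_charSumCyclo_eq_iff k⁻¹ c 1).mp
      (fun ψ => by rw [h ψ _ (E.H.inv_mem hk), Int.cast_one, one_mul]) g
    rwa [inv_inv, one_mul] at this
  · intro h ψ k hk
    have := (gal_charSumCyclo_eq_iff k c 1).mpr
      (fun g => by rw [h _ (E.H.inv_mem hk), one_mul]) ψ
    rwa [Int.cast_one, one_mul] at this

theorem isIntegral_charSum (ψ : AddChar G ℂ) : IsIntegral ℤ (charSum c ψ) := by
  refine IsIntegral.sum _ fun g _ => IsIntegral.mul isIntegral_algebraMap ?_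
  refine IsIntegral.of_pow (NeZero.pos (AddMonoid.exponent G)) ?_
  rw [addChar_pow_exponent]
  exact isIntegral_one

theorem charSum_eq_int_mul_sqrt_iff :
    (∀ ψ, ∃ a : ℤ, charSum c ψ = a * Complex.sqrt (E.delta : ℂ)) ↔
      ∀ k g, c (unitMul k g) = E.chi k * c g := by
  constructor
  · intro h k g
    obtain ⟨s, hs, -, hσ⟩ := E.exists_sqrt_delta
    have := (gal_charSumCyclo_eq_iff k⁻¹ c (E.chi k)).mp (fun ψ => by
      obtain ⟨a, ha⟩ := h ψ
      have hx : charSumCyclo c ψ = (a : cyclo _) * s := by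
        refine Subtype.ext ?_
        rw [coe_charSumCyclo, ha, ← hs]
        push_cast
        rfl
      rw [hx, map_mul, map_intCast, hσ, E.chi_inv]
      ring) g
    rwa [inv_inv] at this
  · intro h ψ
    obtain ⟨q, hq⟩ := E.exists_rat_mul_sqrt (x := charSumCyclo c ψ) fun k =>
      (gal_charSumCyclo_eq_iff k c (E.chi k)).mpr (fun g => by rw [h, E.chi_inv]) ψ
    rw [coe_charSumCyclo] at hq
    -- The eigenvalue is `q √Δ` with `q` rational; its square `q ^ 2 Δ` is a rational algebraic
    -- integer, and `Δ` square-free forces `q` to be an integer.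
    have hint := (isIntegral_charSum c ψ).pow 2
    have hsq : charSum c ψ ^ 2 = algebraMap ℚ ℂ (q ^ 2 * E.delta) := by
      rw [hq, mul_pow, sqrt_sq]
      simp
    rw [hsq, isIntegral_algebraMap_iff (algebraMap ℚ ℂ).injective] at hint
    obtain ⟨m, hm⟩ := IsIntegrallyClosed.isIntegral_iff.mp hint
    obtain ⟨a, rfl⟩ := exists_int_of_sq_mul_squarefree E.squarefree_delta (q := q) (m := m)
      (by rw [← hm]; simp)
    exact ⟨a, by rw [hq]; simp⟩

theorem charSum_conj (ψ : AddChar G ℂ) :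
    (starRingEnd ℂ) (charSum c ψ) = charSum (fun g => c (-g)) ψ := by
  rw [charSum, charSum, map_sum, ← Equiv.sum_comp (Equiv.neg G)]
  refine Finset.sum_congr rfl fun g _ => ?_
  simp [AddChar.map_neg_eq_conj]

end GaloisAction

/-! ### Complex conjugation and the sign of `Δ` -/

section Signs

theorem conj_sqrt_of_neg {D : ℤ} (hD : D < 0) :
    (starRingEnd ℂ) (Complex.sqrt (D : ℂ)) = -Complex.sqrt (D : ℂ) := by
  have h := sqrt_sq (D : ℂ)
  generalize Complex.sqrt (D : ℂ) = s at h
  have hre := congrArg Complex.re h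
  have him := congrArg Complex.im h
  simp only [sq, Complex.mul_re, Complex.mul_im, Complex.intCast_re, Complex.intCast_im] at hre him
  have hD' : (D : ℝ) < 0 := by exact_mod_cast hD
  have h0 : s.re = 0 := by
    by_contra h1
    have h2 : s.im = 0 := by
      have : s.re * s.im = 0 := by linarith
      exact (mul_eq_zero.mp this).resolve_left h1
    rw [h2] at hre
    nlinarith [mul_self_nonneg s.re]
  apply Complex.ext <;> simp [h0]

theorem conj_sqrt_of_pos {D : ℤ} (hD : 0 < D) :
    (starRingEnd ℂ) (Complex.sqrt (D : ℂ)) = Complex.sqrt (D : ℂ) := by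
  have h := sqrt_sq (D : ℂ)
  generalize Complex.sqrt (D : ℂ) = s at h
  have hre := congrArg Complex.re h
  have him := congrArg Complex.im h
  simp only [sq, Complex.mul_re, Complex.mul_im, Complex.intCast_re, Complex.intCast_im] at hre him
  have hD' : (0 : ℝ) < D := by exact_mod_cast hD
  have h0 : s.im = 0 := by
    by_contra h1
    have h2 : s.re = 0 := by
      have : s.re * s.im = 0 := by linarith
      exact (mul_eq_zero.mp this).resolve_right h1
    rw [h2] at hre
    nlinarith [mul_self_nonneg s.im]
  apply Complex.ext <;> simp [h0]

variable {G : Type*} [AddCommGroup G] [Fintype G] {c : G → ℤ} {D : ℤ}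

/-- Conjugation negates every eigenvalue and replaces `c(g)` by `c(-g)`; compare coefficients. No
evaluation of `χ_Δ(-1)` is needed. -/
theorem coeff_neg_of_neg (hD : D < 0)
    (h : ∀ ψ, ∃ a : ℤ, charSum c ψ = a * Complex.sqrt (D : ℂ)) (g : G) : c (-g) = -c g := by
  refine congrFun (charSum_injective (a₁ := fun g => c (-g)) (a₂ := fun g => -c g)
    (funext fun ψ => ?_)) g
  obtain ⟨a, ha⟩ := h ψ
  have hneg : charSum (fun g => -c g) ψ = -charSum c ψ := by simp [charSum]
  rw [← charSum_conj, hneg, ha, map_mul, conj_sqrt_of_neg hD, map_intCast, mul_neg]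

theorem coeff_neg_of_pos (hD : 0 < D)
    (h : ∀ ψ, ∃ a : ℤ, charSum c ψ = a * Complex.sqrt (D : ℂ)) (g : G) : c (-g) = c g := by
  refine congrFun (charSum_injective (a₁ := fun g => c (-g)) (a₂ := c) (funext fun ψ => ?_)) g
  obtain ⟨a, ha⟩ := h ψ
  rw [← charSum_conj, ha, map_mul, conj_sqrt_of_pos hD, map_intCast]

end Signs

/-! ### Unions of classes as `H_Δ`-stable sets -/

section UnionOfClasses

variable {G : Type*} [AddCommGroup G]

theorem isUnionOfClasses_iff {E : Exponents (AddMonoid.exponent G)} {C : Set G} :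
    IsUnionOfClasses (equivRel E) C ↔ ∀ k ∈ E.H, ∀ g, unitMul k g ∈ C ↔ g ∈ C := by
  constructor
  · rintro ⟨S, hS, rfl⟩ k hk g
    have hrel : (equivRel E) (unitMul k g) g := ⟨k, hk, rfl⟩
    simp only [Set.mem_sUnion]
    constructor
    · rintro ⟨T, hT, hg⟩
      obtain ⟨y, rfl⟩ := hS hT
      exact ⟨_, hT, (equivRel E).trans ((equivRel E).symm hrel) hg⟩
    · rintro ⟨T, hT, hg⟩
      obtain ⟨y, rfl⟩ := hS hT
      exact ⟨_, hT, (equivRel E).trans hrel hg⟩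
  · intro h
    refine ⟨{T | ∃ y ∈ C, T = {x | (equivRel E) x y}}, ?_, ?_⟩
    · rintro _ ⟨y, -, rfl⟩
      exact ⟨y, rfl⟩
    · ext g
      constructor
      · intro hg
        exact ⟨_, ⟨g, hg, rfl⟩, (equivRel E).refl g⟩
      · rintro ⟨_, ⟨y, hy, rfl⟩, k, hk, rfl⟩
        exact (h k hk y).mpr hy

theorem mem_image_unitMul {k : (ZMod (AddMonoid.exponent G))ˣ} {C : Set G} {g : G} :
    g ∈ unitMul k '' C ↔ unitMul k⁻¹ g ∈ C := by
  constructor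
  · rintro ⟨x, hx, rfl⟩
    rwa [unitMul_inv_unitMul]
  · intro h
    exact ⟨_, h, unitMul_unitMul_inv k g⟩

theorem IsUnionOfClasses.image_unitMul {E : Exponents (AddMonoid.exponent G)} {C : Set G}
    (h : IsUnionOfClasses (equivRel E) C) (k : (ZMod (AddMonoid.exponent G))ˣ) :
    IsUnionOfClasses (equivRel E) (unitMul k '' C) := by
  rw [isUnionOfClasses_iff] at h ⊢
  intro l hl g
  rw [mem_image_unitMul, mem_image_unitMul, ← unitMul_mul, mul_comm, unitMul_mul, h l hl]

end UnionOfClasses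

/-! ### From symmetries of the coefficients to `C₁`, `C₂` and their Cayley graphs -/

section Coefficients

variable {G : Type*} [AddCommGroup G] [DecidableEq G]

/-- The coefficient of `A_g` in `A_{C₁} - A_{C₂}`. -/
def coeff (C₁ C₂ : Finset G) (g : G) : ℤ := (if g ∈ C₁ then 1 else 0) - (if g ∈ C₂ then 1 else 0)

variable {C₁ C₂ : Finset G}

omit [AddCommGroup G] in
theorem coeff_eq_one_iff (hd : Disjoint C₁ C₂) {g : G} : coeff C₁ C₂ g = 1 ↔ g ∈ C₁ := by
  have : g ∈ C₁ → g ∉ C₂ := fun h => Finset.disjoint_left.mp hd h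
  unfold coeff
  split_ifs <;> simp_all

omit [AddCommGroup G] in
theorem coeff_eq_neg_one_iff (hd : Disjoint C₁ C₂) {g : G} : coeff C₁ C₂ g = -1 ↔ g ∈ C₂ := by
  have : g ∈ C₁ → g ∉ C₂ := fun h => Finset.disjoint_left.mp hd h
  unfold coeff
  split_ifs <;> simp_all

theorem connMatrix_apply [Fintype G] (C : Finset G) (u v : G) :
    connMatrix C u v = if v - u ∈ C then 1 else 0 := by
  simp [connMatrix, Matrix.sum_apply, schemeMatrix]

theorem connMatrix_sub_connMatrix [Fintype G] :
    connMatrix C₁ - connMatrix C₂ = weightedMatrix (coeff C₁ C₂) := by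
  ext u v
  simp [connMatrix_apply, weightedMatrix, coeff]

theorem coeff_unitMul_eq_iff (hd : Disjoint C₁ C₂) (E : Exponents (AddMonoid.exponent G)) :
    (∀ k ∈ E.H, ∀ g, coeff C₁ C₂ (unitMul k g) = coeff C₁ C₂ g) ↔
      IsUnionOfClasses (equivRel E) (C₁ : Set G) ∧ IsUnionOfClasses (equivRel E) (C₂ : Set G) := by
  simp only [isUnionOfClasses_iff, Finset.mem_coe]
  constructor
  · intro h
    constructor <;> intro k hk g
    · rw [← coeff_eq_one_iff hd, h k hk g, coeff_eq_one_iff hd]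
    · rw [← coeff_eq_neg_one_iff hd, h k hk g, coeff_eq_neg_one_iff hd]
  · rintro ⟨h1, h2⟩ k hk g
    simp only [coeff, h1 k hk, h2 k hk]

variable [Fintype G]

/-- Units in `H_Δ` preserve the sets where the coefficient is `1` and `-1`, and units outside
exchange them. One exchanging unit `l` suffices: for `k, l ∉ H_Δ` both `k l⁻¹` and `k l` lie in
`H_Δ`. -/
theorem coeff_unitMul_eq_chi_mul_iff (hd : Disjoint C₁ C₂) (E : Exponents (AddMonoid.exponent G)) :
    (∀ k g, coeff C₁ C₂ (unitMul k g) = E.chi k * coeff C₁ C₂ g) ↔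
      (E.delta = 1 ∧ IsUnionOfClasses (equivRel E) (C₁ : Set G) ∧
        IsUnionOfClasses (equivRel E) (C₂ : Set G)) ∨
      (E.delta ≠ 1 ∧ (∃ k, k ∉ E.H ∧ (C₂ : Set G) = unitMul k '' (C₁ : Set G)) ∧
        IsUnionOfClasses (equivRel E) (C₁ : Set G)) := by
  constructor
  · intro h
    have hU := (coeff_unitMul_eq_iff hd E).mp fun k hk g => by
      rw [h, Exponents.mem_H.mp hk, one_mul]
    by_cases hD : E.delta = 1
    · exact Or.inl ⟨hD, hU⟩
    · obtain ⟨k, hk⟩ := Exponents.exists_notMem_H hD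
      refine Or.inr ⟨hD, ⟨k, hk, ?_⟩, hU.1⟩
      ext g
      rw [mem_image_unitMul, Finset.mem_coe, Finset.mem_coe, ← coeff_eq_one_iff hd, h, E.chi_inv,
        Exponents.chi_eq_neg_one hk, ← coeff_eq_neg_one_iff hd]
      omega
  · rintro (⟨hD, hU⟩ | ⟨-, ⟨l, hl, hC⟩, hU⟩) k g
    · have hk := E.delta_eq_one_iff.mp hD k
      rw [(coeff_unitMul_eq_iff hd E).mpr hU k hk, Exponents.mem_H.mp hk, one_mul]
    · have hU2 : IsUnionOfClasses (equivRel E) (C₂ : Set G) := hC ▸ hU.image_unitMul l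
      by_cases hk : k ∈ E.H
      · rw [(coeff_unitMul_eq_iff hd E).mpr ⟨hU, hU2⟩ k hk, Exponents.mem_H.mp hk, one_mul]
      · have hm : ∀ x, x ∈ C₂ ↔ unitMul l⁻¹ x ∈ C₁ := fun x => by
          rw [← Finset.mem_coe, hC, mem_image_unitMul, Finset.mem_coe]
        have hinv := isUnionOfClasses_iff.mp hU
        have h1 : unitMul k g ∈ C₂ ↔ g ∈ C₁ := by
          rw [hm, ← unitMul_mul]
          refine hinv _ ?_ g
          rw [Exponents.mem_H, E.chi_mul, E.chi_inv, Exponents.chi_eq_neg_one hk,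
            Exponents.chi_eq_neg_one hl]
          norm_num
        have h2 : unitMul k g ∈ C₁ ↔ g ∈ C₂ := by
          have h3 : unitMul k g = unitMul (k * l) (unitMul l⁻¹ g) := by
            rw [← unitMul_mul, mul_assoc, mul_inv_cancel, mul_one]
          rw [hm, h3]
          refine hinv _ ?_ _
          rw [Exponents.mem_H, E.chi_mul, Exponents.chi_eq_neg_one hk,
            Exponents.chi_eq_neg_one hl]
          norm_num
        rw [Exponents.chi_eq_neg_one hk]
        simp only [coeff, h1, h2]
        ring

theorem isOriented_and_eq_skewAdjMatrix (hd : Disjoint C₁ C₂)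
    (h : ∀ g, coeff C₁ C₂ (-g) = -coeff C₁ C₂ g) :
    IsOriented (cayleyDigraph C₁) ∧
      connMatrix C₁ - connMatrix C₂ = skewAdjMatrix (cayleyDigraph C₁) := by
  have hneg : ∀ g, -g ∈ C₁ ↔ g ∈ C₂ := fun g => by
    rw [← coeff_eq_one_iff hd, h, ← coeff_eq_neg_one_iff hd]
    omega
  have hsub : ∀ u v : G, u - v ∈ C₁ ↔ v - u ∈ C₂ := fun u v => by rw [← hneg, neg_sub]
  refine ⟨fun u v huv hvu => Finset.disjoint_left.mp hd huv ((hsub u v).mp hvu), ?_⟩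
  ext u v
  have : v - u ∈ C₁ → v - u ∉ C₂ := fun h => Finset.disjoint_left.mp hd h
  simp only [Matrix.sub_apply, connMatrix_apply, skewAdjMatrix, Matrix.of_apply, cayleyDigraph, hsub]
  split_ifs <;> simp_all

theorem exists_eq_signedCayley_adjMatrix (hd : Disjoint C₁ C₂) (h0 : 0 ∉ C₁ ∪ C₂)
    (h : ∀ g, coeff C₁ C₂ (-g) = coeff C₁ C₂ g) :
    ∃ (h₁ : IsConnectionSet C₁) (h₂ : IsConnectionSet C₂),
      connMatrix C₁ - connMatrix C₂ = (signedCayley C₁ C₂ h₁ h₂ hd).adjMatrix := by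
  rw [Finset.mem_union, not_or] at h0
  refine ⟨⟨h0.1, fun g hg => ?_⟩, ⟨h0.2, fun g hg => ?_⟩, ?_⟩
  · rwa [← coeff_eq_one_iff hd, h, coeff_eq_one_iff hd]
  · rwa [← coeff_eq_neg_one_iff hd, h, coeff_eq_neg_one_iff hd]
  · ext u v
    have : v - u ∈ C₁ → v - u ∉ C₂ := fun h => Finset.disjoint_left.mp hd h
    simp only [Matrix.sub_apply, connMatrix_apply, SignedGraph.adjMatrix, Matrix.of_apply,
      signedCayley, cayleyGraph]
    split_ifs <;> simp_all

end Coefficients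

/-! ### The fields generated by eigenvalues of `(0, 1, -1)`-matrices -/

section Existence

variable {G : Type*} [AddCommGroup G] [Fintype G] [DecidableEq G]

theorem weightedMatrix_mem_boseMesner (c : G → ℤ) : weightedMatrix c ∈ boseMesner G := by
  have : weightedMatrix c = ∑ g, (c g : ℂ) • schemeMatrix g := by
    ext u v
    simp [weightedMatrix, Matrix.sum_apply, schemeMatrix]
  rw [this]
  exact Submodule.sum_mem _ fun g _ => Submodule.smul_mem _ _ (Submodule.subset_span ⟨g, rfl⟩)

omit [Fintype G] in
theorem apply_eq_of_mem_boseMesner {M : Matrix G G ℂ} (hM : M ∈ boseMesner G) (u v : G) :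
    M u v = M 0 (v - u) := by
  induction hM using Submodule.span_induction with
  | mem x hx =>
    obtain ⟨g, rfl⟩ := hx
    simp [schemeMatrix]
  | zero => rfl
  | add x y _ _ hx hy => rw [Matrix.add_apply, hx, hy, Matrix.add_apply]
  | smul a x _ hx => rw [Matrix.smul_apply, hx, Matrix.smul_apply]

omit [Fintype G] in
theorem exists_eq_weightedMatrix {M : Matrix G G ℂ} (hM : M ∈ boseMesner G)
    (h : IsZeroOneNegOne M) : ∃ c : G → ℤ, M = weightedMatrix c := by
  have : ∀ g, ∃ a : ℤ, M 0 g = a := fun g => by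
    rcases h 0 g with h | h | h
    exacts [⟨0, by simp [h]⟩, ⟨1, by simp [h]⟩, ⟨-1, by simp [h]⟩]
  choose c hc using this
  refine ⟨c, ?_⟩
  ext u v
  rw [apply_eq_of_mem_boseMesner hM, hc]
  rfl

omit [Fintype G] [DecidableEq G] in
theorem unitMul_injective_of_addOrderOf {g : G} (hg : addOrderOf g = AddMonoid.exponent G)
    {k l : (ZMod (AddMonoid.exponent G))ˣ} (h : unitMul k g = unitMul l g) : k = l := by
  rw [unitMul, unitMul, zsmul_eq_zsmul_iff_modEq, hg, ← ZMod.intCast_eq_intCast_iff] at h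
  exact Units.ext (by simpa using h)

/-- Since `c` is not invariant under `a`, some eigenvalue is moved by the Galois group. It equals `q
+ r √Δ` with `r ≠ 0`, so `√Δ` can be solved for. -/
theorem adjoin_eigenvalues_eq_quadField {E : Exponents (AddMonoid.exponent G)} {c : G → ℤ}
    (h : ∀ k ∈ E.H, ∀ g, c (unitMul k g) = c g) {a : (ZMod (AddMonoid.exponent G))ˣ} {g : G}
    (ha : c (unitMul a g) ≠ c g) :
    IntermediateField.adjoin ℚ (eigenvalues (weightedMatrix c)) = quadField E.delta := by
  have hmem := (charSum_mem_quadField_iff E c).mpr h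
  rw [eigenvalues_weightedMatrix]
  refine le_antisymm (IntermediateField.adjoin_le_iff.mpr ?_)
    (IntermediateField.adjoin_le_iff.mpr ?_)
  · rintro _ ⟨ψ, rfl⟩
    exact hmem ψ
  · rintro _ rfl
    obtain ⟨ψ, hψ⟩ : ∃ ψ, gal _ a⁻¹ (charSumCyclo c ψ) ≠ charSumCyclo c ψ := by
      by_contra! hc
      refine ha ?_
      have := (gal_charSumCyclo_eq_iff a⁻¹ c 1).mp
        (fun ψ => by rw [hc, Int.cast_one, one_mul]) g
      rwa [inv_inv, one_mul] at this
    obtain ⟨q, r, hqr⟩ := E.exists_rat_add_rat_mul_sqrt (x := charSumCyclo c ψ)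
      (E.mem_quadField_iff.mp (by rw [coe_charSumCyclo]; exact hmem ψ))
    have hr : r ≠ 0 := by
      rintro rfl
      refine hψ ?_
      have : charSumCyclo c ψ = algebraMap ℚ _ q := Subtype.ext (by rw [hqr]; simp)
      rw [this, AlgEquiv.commutes]
    have hr' : (r : ℂ) ≠ 0 := by exact_mod_cast hr
    rw [coe_charSumCyclo] at hqr
    have hs : Complex.sqrt (E.delta : ℂ) =
        (charSum c ψ - algebraMap ℚ ℂ q) * algebraMap ℚ ℂ r⁻¹ := by
      rw [hqr]
      simp only [eq_ratCast, Rat.cast_inv]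
      field_simp
      ring
    rw [hs]
    exact mul_mem (sub_mem (IntermediateField.subset_adjoin ℚ _ ⟨ψ, rfl⟩)
      (IntermediateField.algebraMap_mem _ q)) (IntermediateField.algebraMap_mem _ _)

theorem exists_matrix_adjoin_eq_quadField (E : Exponents (AddMonoid.exponent G)) :
    ∃ M ∈ boseMesner G, IsZeroOneNegOne M ∧
      IntermediateField.adjoin ℚ (eigenvalues M) = quadField E.delta := by
  classical
  by_cases hD : E.delta = 1
  · refine ⟨weightedMatrix 0, weightedMatrix_mem_boseMesner _, fun u v => Or.inl ?_, ?_⟩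
    · simp [weightedMatrix]
    · have h1 : quadField E.delta = ⊥ := by
        rw [hD, quadField, Int.cast_one, Complex.sqrt_one, IntermediateField.adjoin_one]
      rw [eigenvalues_weightedMatrix, h1, IntermediateField.adjoin_eq_bot_iff]
      rintro _ ⟨ψ, rfl⟩
      simp [charSum]
  · obtain ⟨a, ha⟩ := Exponents.exists_notMem_H hD
    -- Units act freely on an element of order `n₁`, so the indicator of its `H_Δ`-orbit is stable
    -- under `H_Δ` but not under `a`.
    obtain ⟨g, hg⟩ := AddMonoid.exists_addOrderOf_eq_exponent
      (AddMonoid.ExponentExists.of_finite (G := G))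
    have hm : ∀ l, (∃ k ∈ E.H, unitMul l g = unitMul k g) ↔ l ∈ E.H := fun l =>
      ⟨fun ⟨k, hk, h⟩ => unitMul_injective_of_addOrderOf hg h ▸ hk, fun hl => ⟨l, hl, rfl⟩⟩
    refine ⟨weightedMatrix fun x => if ∃ k ∈ E.H, x = unitMul k g then 1 else 0,
      -- The base point is written `unitMul 1 g` so that `hm` decides membership in the orbit for
      -- both `1` and `a`.
      weightedMatrix_mem_boseMesner _, fun u v => ?_, adjoin_eigenvalues_eq_quadField
        (fun k hk x => ?_) (a := a) (g := unitMul 1 g) ?_⟩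
    · simp only [weightedMatrix, Matrix.of_apply]
      split_ifs <;> simp
    · refine if_congr ⟨?_, ?_⟩ rfl rfl
      · rintro ⟨l, hl, h⟩
        refine ⟨k⁻¹ * l, E.H.mul_mem (E.H.inv_mem hk) hl, ?_⟩
        rw [unitMul_mul, ← h, unitMul_inv_unitMul]
      · rintro ⟨l, hl, rfl⟩
        exact ⟨k * l, E.H.mul_mem hk hl, (unitMul_mul k l g).symm⟩
    · rw [← unitMul_mul, mul_one]
      simp only [hm, ha, E.H.one_mem, if_true, if_false]
      norm_num

theorem exists_exponents_of_adjoin_eigenvalues {D : ℤ} (hD : Squarefree D) {M : Matrix G G ℂ}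
    (hM : M ∈ boseMesner G) (h01 : IsZeroOneNegOne M)
    (h : IntermediateField.adjoin ℚ (eigenvalues M) = quadField D) :
    ∃ E : Exponents (AddMonoid.exponent G), D = E.delta := by
  obtain ⟨c, rfl⟩ := exists_eq_weightedMatrix hM h01
  refine exists_exponents_of_sqrt_mem_cyclo hD ?_
  have hle : quadField D ≤ cyclo (AddMonoid.exponent G) := by
    rw [← h, eigenvalues_weightedMatrix]
    refine IntermediateField.adjoin_le_iff.mpr ?_
    rintro _ ⟨ψ, rfl⟩
    rw [← coe_charSumCyclo]
    exact (charSumCyclo c ψ).2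
  exact hle (sqrt_mem_quadField D)

end Existence

end CayleyEig

theorem mainTheorem1 (G : Type*) [AddCommGroup G] [Fintype G] [DecidableEq G] :
    -- which square-free integers occur
    (∀ Δ₀ : ℤ, Squarefree Δ₀ →
      ((∃ M ∈ CayleyEig.boseMesner G, CayleyEig.IsZeroOneNegOne M ∧
          IntermediateField.adjoin ℚ (CayleyEig.eigenvalues M) = CayleyEig.quadField Δ₀) ↔
        ∃ E : CayleyEig.Exponents (AddMonoid.exponent G), Δ₀ = E.delta)) ∧
    ∀ E : CayleyEig.Exponents (AddMonoid.exponent G),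
      (E.delta ≠ 1 → E.H.index = 2) ∧
      ∀ C₁ C₂ : Finset G, ∀ hd : Disjoint C₁ C₂, 0 ∉ C₁ ∪ C₂ →
        -- part (i)
        ((∀ μ ∈ CayleyEig.eigenvalues (CayleyEig.connMatrix C₁ - CayleyEig.connMatrix C₂),
            μ ∈ CayleyEig.quadField E.delta) ↔
          CayleyEig.IsUnionOfClasses (CayleyEig.equivRel E) (C₁ : Set G) ∧
          CayleyEig.IsUnionOfClasses (CayleyEig.equivRel E) (C₂ : Set G)) ∧
        -- part (ii)
        ((∀ μ ∈ CayleyEig.eigenvalues (CayleyEig.connMatrix C₁ - CayleyEig.connMatrix C₂),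
            ∃ a : ℤ, μ = a * Complex.sqrt (E.delta : ℂ)) ↔
          (E.delta = 1 ∧
            CayleyEig.IsUnionOfClasses (CayleyEig.equivRel E) (C₁ : Set G) ∧
            CayleyEig.IsUnionOfClasses (CayleyEig.equivRel E) (C₂ : Set G)) ∨
          (E.delta ≠ 1 ∧
            (∃ k : (ZMod (AddMonoid.exponent G))ˣ, k ∉ E.H ∧
              (C₂ : Set G) = CayleyEig.unitMul k '' (C₁ : Set G)) ∧
            CayleyEig.IsUnionOfClasses (CayleyEig.equivRel E) (C₁ : Set G))) ∧
        -- in the second case of (ii) the set `C₂` is a union of classes too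
        (∀ k : (ZMod (AddMonoid.exponent G))ˣ, k ∉ E.H →
          (C₂ : Set G) = CayleyEig.unitMul k '' (C₁ : Set G) →
          CayleyEig.IsUnionOfClasses (CayleyEig.equivRel E) (C₁ : Set G) →
          CayleyEig.IsUnionOfClasses (CayleyEig.equivRel E) (C₂ : Set G)) ∧
        -- in (ii), negative `Δ` gives oriented graphs and positive `Δ` gives signed ones
        ((∀ μ ∈ CayleyEig.eigenvalues (CayleyEig.connMatrix C₁ - CayleyEig.connMatrix C₂),
            ∃ a : ℤ, μ = a * Complex.sqrt (E.delta : ℂ)) →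
          (E.delta < 0 →
            CayleyEig.IsOriented (CayleyEig.cayleyDigraph C₁) ∧
            CayleyEig.connMatrix C₁ - CayleyEig.connMatrix C₂ =
              CayleyEig.skewAdjMatrix (CayleyEig.cayleyDigraph C₁)) ∧
          (0 < E.delta →
            ∃ (h₁ : CayleyEig.IsConnectionSet C₁) (h₂ : CayleyEig.IsConnectionSet C₂),
              CayleyEig.connMatrix C₁ - CayleyEig.connMatrix C₂ =
                (CayleyEig.signedCayley C₁ C₂ h₁ h₂ hd).adjMatrix)) := by
  refine ⟨fun D hD => ⟨fun ⟨M, hM, h01, h⟩ =>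
    CayleyEig.exists_exponents_of_adjoin_eigenvalues hD hM h01 h, ?_⟩, fun E =>
    ⟨CayleyEig.Exponents.index_H, fun C₁ C₂ hd h0 => ?_⟩⟩
  · rintro ⟨E, rfl⟩
    exact CayleyEig.exists_matrix_adjoin_eq_quadField E
  rw [CayleyEig.connMatrix_sub_connMatrix, CayleyEig.eigenvalues_weightedMatrix]
  simp only [Set.forall_mem_range]
  refine ⟨?_, ?_, fun k _ hC hU => hC ▸ hU.image_unitMul k, fun h => ⟨fun hD => ?_, fun hD => ?_⟩⟩
  · rw [CayleyEig.charSum_mem_quadField_iff, CayleyEig.coeff_unitMul_eq_iff hd]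
  · rw [CayleyEig.charSum_eq_int_mul_sqrt_iff, CayleyEig.coeff_unitMul_eq_chi_mul_iff hd]
  · rw [← CayleyEig.connMatrix_sub_connMatrix]
    exact CayleyEig.isOriented_and_eq_skewAdjMatrix hd (CayleyEig.coeff_neg_of_neg hD h)
  · rw [← CayleyEig.connMatrix_sub_connMatrix]
    exact CayleyEig.exists_eq_signedCayley_adjMatrix hd h0 (CayleyEig.coeff_neg_of_pos hD h)
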